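/- Let $d\ge 2$, let $\mathcal H$ be a $d$-dimensional complex Hilbert space, let $P_\pm=(I\pm S)/2$ be the orthogonal projectors on the symmetric and antisymmetric subspaces of $\mathcal H_B\otimes\mathcal H_E=\mathcal H\otimes\mathcal H$ ($S$ the swap), with dimensions $d_\pm=d(d\pm1)/2$. The Choi operator of a linear map $\mathcal C$ is $(\mathcal C\otimes\mathcal I)(|I\rangle\langle I|)$ with $|I\rangle=\sum_i|i\rangle|i\rangle$, and $|U\rangle=(U\otimes I)|I\rangle$. A one-to-two cloning network is a non-negative operator $R$ on $\mathcal H_0\otimes\mathcal H_1\otimes\mathcal H_2\otimes\mathcal H_3$ ($\mathcal H_1=\mathcal H_2=\mathcal H$, $\mathcal H_0=\mathcal H_3=\mathcal H_B\otimes\mathcal H_E$) with $\mathrm{Tr}_3R=I_2\otimes R^{(0)}$ and $\mathrm{Tr}_1R^{(0)}=I_0$ for some $R^{(0)}\ge0$ on $\mathcal H_0\otimes\mathcal H_1$; inserting a unitary gate $U$ gives the channel with Choi operator $C_U=\mathrm{Tr}_{1,2}[(I_0\otimes|U^*\rangle\langle U^*|_{1,2}\otimes I_3)R]$. Its average global channel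 fidelity is $F=\int dU\,\frac1{d^4}\mathrm{Tr}[C_U\,|U\rangle\langle U|^{\otimes2}]$, with $dU$ the normalized Haar measure on $U(d)$. (1) The maximum of $F$ over all one-to-two cloning networks is $$F_{clon}=\frac{d+\sqrt{d^2-1}}{d^3}=\frac{(\sqrt{d_+}+\sqrt{d_-})^2}{d^4},$$ which is about $46.65\%$ for $d=2$. It is also the maximum of the average fidelity over all sequential networks $\mathcal B\circ(\mathcal U\otimes\mathcal I_{\mathcal M})\circ\mathcal A$, where $\mathcal M$ is a finite-dimensional memory, $\mathcal A$ a channel from $\mathcal H_B\otimes\mathcal H_E$ to $\mathcal H\otimes\mathcal M$, $\mathcal U(\rho)=U\rho U^\dagger$, and $\mathcal B$ a channel from $\mathcal H\otimes\mathcal M$ to $\mathcal H_B\otimes\mathcal H_E$. (2) The maximum is attained by the sequential network with a memory qubit $\mathcal M$, with orthonormal basis $|+\rangle,|-\rangle$, and with $$\mathcal A(\rho)=\sum_{i,j=\pm}\mathrm{Tr}_E[P_i\rho P_j]\otimes|i\rangle\langle j|,\qquad \mathcal B(\sigma)=\sum_{i,j=\pm}\frac d{\sqrt{d_id_j}}\,P_i\big[\langle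 i|\sigma|j\rangle\otimes I\big]P_j ,$$ which are both channels; a one-to-two cloning network as defined above yields the same channels for all $U$. Moreover $\mathcal A(\rho)=\mathrm{Tr}_E[V(\rho\otimes|+\rangle\langle+|)V^\dagger]$, where $V=I\otimes|0\rangle\langle0|+S\otimes|1\rangle\langle1|$ is the unitary controlled swap, with $|0\rangle=(|+\rangle+|-\rangle)/\sqrt2$ and $|1\rangle=(|+\rangle-|-\rangle)/\sqrt2$. (3) For every unitary $U$ the resulting clone is the channel $$\mathcal C'_U(\rho)=\mathcal B\circ(\mathcal U\otimes\mathcal I_{\mathcal M})\circ\mathcal A(\rho)=\sum_{i,j=\pm}\frac d{\sqrt{d_id_j}}\,P_i\big[U\,\mathrm{Tr}_E[P_i\rho P_j]\,U^\dagger\otimes I\big]P_j ,$$ and its channel fidelity with $U\otimes U$ is $F_{clon}$. -/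

import Mathlib

open scoped Kronecker ComplexOrder

noncomputable section

namespace UnitaryCloning

/-! ### Operators, channels, Choi operators -/

/-- Operators on the Hilbert space with orthonormal basis indexed by `n`. -/
abbrev Op (n : Type) := Matrix n n ℂ

section General

variable {n m : Type}

/-- The map `Φ ⊗ id` on operators on `H_n ⊗ H_k`: apply `Φ` to every block of the operator. -/
def tensorId (k : Type) (Φ : Op n →ₗ[ℂ] Op m) : Op (n × k) →ₗ[ℂ] Op (m × k) where
  toFun X := Matrix.of fun p q => Φ (Matrix.of fun i j => X (i, p.2) (j, q.2)) p.1 q.1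
  map_add' X Y := by
    ext p q
    have h : (Matrix.of fun i j => (X + Y) (i, p.2) (j, q.2) : Op n)
        = (Matrix.of fun i j => X (i, p.2) (j, q.2)) +
          (Matrix.of fun i j => Y (i, p.2) (j, q.2)) := rfl
    simp only [Matrix.of_apply, Matrix.add_apply] at h ⊢
    rw [h, map_add]
    rfl
  map_smul' c X := by
    ext p q
    have h : (Matrix.of fun i j => (c • X) (i, p.2) (j, q.2) : Op n)
        = c • (Matrix.of fun i j => X (i, p.2) (j, q.2)) := rfl
    simp only [Matrix.of_apply, Matrix.smul_apply, RingHom.id_apply] at h ⊢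
    rw [h, map_smul]
    rfl

/-- Complete positivity: `Φ ⊗ id_k` preserves positive semidefiniteness for every `k`. -/
def IsCompletelyPositive (Φ : Op n →ₗ[ℂ] Op m) : Prop :=
  ∀ (k : ℕ) (X : Op (n × Fin k)), X.PosSemidef → (tensorId (Fin k) Φ X).PosSemidef

/-- Quantum channels: completely positive trace-preserving maps. -/
def IsChannel [Fintype n] [Fintype m] (Φ : Op n →ₗ[ℂ] Op m) : Prop :=
  IsCompletelyPositive Φ ∧ ∀ X : Op n, (Φ X).trace = X.trace

/-- The unnormalized maximally entangled vector `∑ᵢ |i⟩|i⟩`. -/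
def maxEntangled (n : Type) [DecidableEq n] : n × n → ℂ := fun p => if p.1 = p.2 then 1 else 0

/-- The Choi operator `(Φ ⊗ id)(|I⟩⟨I|)`, an operator on (output) ⊗ (input). -/
def choi [DecidableEq n] (Φ : Op n →ₗ[ℂ] Op m) : Op (m × n) :=
  tensorId n Φ (Matrix.vecMulVec (maxEntangled n) (star (maxEntangled n)))

/-- Conjugation `ρ ↦ U ρ U†`; the unitary channel when `U` is unitary. -/
def unitaryChannel [Fintype n] (U : Op n) : Op n →ₗ[ℂ] Op n where
  toFun ρ := U * ρ * U.conjTranspose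
  map_add' X Y := by rw [Matrix.mul_add, Matrix.add_mul]
  map_smul' c X := by simp

/-- Partial trace over the second tensor factor. -/
def partialTraceRight [Fintype m] : Op (n × m) →ₗ[ℂ] Op n where
  toFun X := Matrix.of fun a b => ∑ z, X (a, z) (b, z)
  map_add' X Y := by ext a b; simp [Finset.sum_add_distrib]
  map_smul' c X := by ext a b; simp [Finset.mul_sum]

/-- Channel fidelity `Tr[C |V⟩⟨V|] / D²` between the channel with Choi operator `C` and the
unitary channel of `V`, where `D` is the dimension of the system. -/
def channelFidelity [Fintype n] [DecidableEq n] (C : Op (n × n)) (V : Op n) : ℝ :=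
  (C * choi (unitaryChannel V)).trace.re / (Fintype.card n : ℝ) ^ 2

end General

/-! ### The normalized Haar measure on the unitary group -/

section Haar

variable (n : Type) [Fintype n] [DecidableEq n]

instance : MeasurableSpace (Matrix.unitaryGroup n ℂ) := borel _

instance : BorelSpace (Matrix.unitaryGroup n ℂ) := ⟨rfl⟩

instance : CompactSpace (Matrix.unitaryGroup n ℂ) := by
  have hK : IsCompact (Set.univ.pi fun _ : n => Set.univ.pi fun _ : n =>
      Metric.closedBall (0 : ℂ) 1) :=
    isCompact_univ_pi fun _ => isCompact_univ_pi fun _ => isCompact_closedBall 0 1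
  have hc : IsClosed ((Matrix.unitaryGroup n ℂ : Set (Matrix n n ℂ))) := isClosed_unitary
  refine isCompact_iff_compactSpace.mp (IsCompact.of_isClosed_subset (X := Matrix n n ℂ) hK hc ?_)
  intro U hU i _ j _
  simpa using entry_norm_bound_of_unitary hU i j

/-- The Haar probability measure on `U(n)`. -/
def unitaryHaar : MeasureTheory.Measure (Matrix.unitaryGroup n ℂ) :=
  MeasureTheory.Measure.haarMeasure ⊤

end Haar

/-! ### Cloning networks -/

section Networks

variable (d : ℕ)

/-- The basis index of `H_B ⊗ H_E`, where both factors have dimension `d`. -/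
abbrev Pair := Fin d × Fin d

/-- The basis index of `H₀ ⊗ H₁ ⊗ H₂ ⊗ H₃`, where `H₀ = H_{0B} ⊗ H_{0E}` is the input of the
network, the open slot goes from `H₁` to `H₂`, and `H₃ = H_{3B} ⊗ H_{3E}` is the output. -/
abbrev NetIdx := Pair d × Fin d × Fin d × Pair d

variable {d}

/-- `R` is the Choi operator of a quantum network with one open slot: `R ≥ 0`,
`Tr₃ R = I₂ ⊗ R⁽⁰⁾` and `Tr₁ R⁽⁰⁾ = I₀` for some `R⁽⁰⁾ ≥ 0` on `H₀ ⊗ H₁`. -/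
def IsNetwork (R : Op (NetIdx d)) : Prop :=
  R.PosSemidef ∧ ∃ R0 : Op (Pair d × Fin d), R0.PosSemidef ∧
    (∀ x0 x1 x2 y0 y1 y2, ∑ x3 : Pair d, R (x0, x1, x2, x3) (y0, y1, y2, x3)
      = (1 : Op (Fin d)) x2 y2 * R0 (x0, x1) (y0, y1)) ∧
    (∀ x0 y0, ∑ x1 : Fin d, R0 (x0, x1) (y0, x1) = (1 : Op (Pair d)) x0 y0)

/-- The Choi operator `Tr_{1,2}[(I₀ ⊗ C* ⊗ I₃) R]` on `H₃ ⊗ H₀` of the channel obtained by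
inserting in the slot of the network `R` the channel with Choi operator `C` on `H₂ ⊗ H₁`
(`C*` is the entrywise complex conjugate). -/
def insertGate (R : Op (NetIdx d)) (C : Op (Fin d × Fin d)) : Op (Pair d × Pair d) :=
  Matrix.of fun p q => ∑ x1 : Fin d, ∑ x2 : Fin d, ∑ z1 : Fin d, ∑ z2 : Fin d,
    star (C (x2, x1) (z2, z1)) * R (p.2, z1, z2, p.1) (q.2, x1, x2, q.1)

/-- The channel `B ∘ (U ⊗ id_M) ∘ A` of a sequential network with pre-processing `A`,
memory `M` of dimension `m`, and post-processing `B`, in which the gate `U` is inserted. -/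
def seqChannel {m : ℕ} (A : Op (Pair d) →ₗ[ℂ] Op (Fin d × Fin m))
    (B : Op (Fin d × Fin m) →ₗ[ℂ] Op (Pair d)) (U : Op (Fin d)) :
    Op (Pair d) →ₗ[ℂ] Op (Pair d) :=
  B ∘ₗ tensorId (Fin m) (unitaryChannel U) ∘ₗ A

/-- The fidelity with `U ⊗ U` of the channel with Choi operator `C U`, averaged over `U`. -/
def averageFidelity (C : Op (Fin d) → Op (Pair d × Pair d)) : ℝ :=
  ∫ U : Matrix.unitaryGroup (Fin d) ℂ,
    channelFidelity (C (U : Op (Fin d))) ((U : Op (Fin d)) ⊗ₖ (U : Op (Fin d)))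
    ∂(unitaryHaar (Fin d))

variable (d)

/-- The average fidelities of all one-slot networks. -/
def networkFidelities : Set ℝ :=
  {F | ∃ R : Op (NetIdx d), IsNetwork R ∧
    F = averageFidelity fun U => insertGate R (choi (unitaryChannel U))}

/-- The average fidelities of all sequential networks, with a finite-dimensional memory. -/
def sequentialFidelities : Set ℝ :=
  {F | ∃ (m : ℕ) (A : Op (Pair d) →ₗ[ℂ] Op (Fin d × Fin m))
      (B : Op (Fin d × Fin m) →ₗ[ℂ] Op (Pair d)), IsChannel A ∧ IsChannel B ∧
    F = averageFidelity fun U => choi (seqChannel A B U)}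

end Networks

/-! ### The optimal network. The basis `|+⟩, |-⟩` of the memory qubit is indexed by `0, 1`. -/

section Optimal

variable (d : ℕ)

/-- The swap operator on `H_B ⊗ H_E`. -/
def swapOp : Op (Pair d) := Matrix.of fun p q => if p.1 = q.2 ∧ p.2 = q.1 then 1 else 0

/-- The orthogonal projectors `P₊ = (I + S)/2`, `P₋ = (I - S)/2` on the symmetric and the
antisymmetric subspace. -/
def proj : Fin 2 → Op (Pair d) :=
  ![(1 / 2 : ℂ) • (1 + swapOp d), (1 / 2 : ℂ) • (1 - swapOp d)]

/-- The dimensions `d₊ = d(d+1)/2`, `d₋ = d(d-1)/2` of these subspaces. -/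
def projDim : Fin 2 → ℝ := ![(d : ℝ) * (d + 1) / 2, (d : ℝ) * (d - 1) / 2]

/-- The pre-processing `A(ρ) = ∑ᵢⱼ Tr_E[Pᵢ ρ Pⱼ] ⊗ |i⟩⟨j|`. -/
def preChannel : Op (Pair d) →ₗ[ℂ] Op (Fin d × Fin 2) where
  toFun ρ := ∑ i : Fin 2, ∑ j : Fin 2,
    partialTraceRight (proj d i * ρ * proj d j) ⊗ₖ Matrix.single i j (1 : ℂ)
  map_add' X Y := by
    simp only [← Finset.sum_add_distrib, Matrix.mul_add, Matrix.add_mul, map_add,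
      Matrix.add_kronecker]
  map_smul' c X := by
    simp only [Finset.smul_sum, Matrix.mul_smul, Matrix.smul_mul, map_smul,
      Matrix.smul_kronecker, RingHom.id_apply]

/-- The block `⟨i|σ|j⟩` of an operator on `H ⊗ M`. -/
def memBlock (i j : Fin 2) (σ : Op (Fin d × Fin 2)) : Op (Fin d) :=
  Matrix.of fun a b => σ (a, i) (b, j)

/-- The post-processing `B(σ) = ∑ᵢⱼ d / √(dᵢ dⱼ) Pᵢ [⟨i|σ|j⟩ ⊗ I] Pⱼ`. -/
def postChannel : Op (Fin d × Fin 2) →ₗ[ℂ] Op (Pair d) where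
  toFun σ := ∑ i : Fin 2, ∑ j : Fin 2,
    (((d : ℝ) / √(projDim d i * projDim d j) : ℝ) : ℂ) •
      (proj d i * (memBlock d i j σ ⊗ₖ (1 : Op (Fin d))) * proj d j)
  map_add' X Y := by
    have h : ∀ i j, memBlock d i j (X + Y) = memBlock d i j X + memBlock d i j Y :=
      fun _ _ => rfl
    simp only [← Finset.sum_add_distrib, h, Matrix.mul_add, Matrix.add_mul,
      Matrix.add_kronecker, smul_add]
  map_smul' c X := by
    have h : ∀ i j, memBlock d i j (c • X) = c • memBlock d i j X := fun _ _ => rfl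
    simp only [Finset.smul_sum, h, Matrix.mul_smul, Matrix.smul_mul,
      Matrix.smul_kronecker, RingHom.id_apply]
    refine Finset.sum_congr rfl fun i _ => Finset.sum_congr rfl fun j _ => smul_comm _ _ _

/-- The controlled swap `I ⊗ |0⟩⟨0| + S ⊗ |1⟩⟨1|`, controlled by the memory qubit in the basis
`|0⟩ = (|+⟩ + |-⟩)/√2`, `|1⟩ = (|+⟩ - |-⟩)/√2`, written in the basis `|+⟩, |-⟩`. -/
def controlledSwap : Op (Pair d × Fin 2) :=
  (1 : Op (Pair d)) ⊗ₖ ((1 / 2 : ℂ) • !![1, 1; 1, 1]) +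
    swapOp d ⊗ₖ ((1 / 2 : ℂ) • !![1, -1; -1, 1])

/-- The optimal fidelity `(d + √(d² - 1)) / d³`. -/
def cloneFidelity : ℝ := (d + √((d : ℝ) ^ 2 - 1)) / (d : ℝ) ^ 3

end Optimal

end UnitaryCloning

end

/-!
The optimal fidelity is `s² / d⁴` with `s = √d₊ + √d₋`; write `ε = ±` for the symmetric and the
antisymmetric sector.

*Upper bound.* If `R = ∑ₙ |vₙ⟩⟨vₙ|` is a one-slot network, its fidelity at the gate `U` is
`∑ₙ |⟨vₙ|ψ⟩|² / d⁴`, where `ψ` collects the matrix entries of `U ⊗ U ⊗ U*`, a map from the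
spaces `0, 1` to the spaces `3, 2` (`channelFidelity_insertGate`). Split `ψ = ψ₊ + ψ₋` along
`P± ⊗ I` and use Cauchy–Schwarz with weights `√d± / s`: it remains to bound the average of
`|⟨vₙ|ψ±⟩|²`. On `P± (H ⊗ H) ⊗ H*` the representation `U ⊗ U ⊗ U*` is the sum of a copy of `H`,
the image of `x ↦ ∑_c (x ⊗ e_c ± e_c ⊗ x) ⊗ e_c*`, and of an irreducible complement of dimension
`d d± - d`, which is zero or at least `d`. The two are inequivalent, so by Schur orthogonality the
mean square of a coefficient is at most `1 / d` times its squared Hilbert–Schmidt norm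
(`integral_norm_sq_le`). The normalization of `R` gives `Tr[R (P± ⊗ I)] = d d±`
(`sum_hsNormSq_regroup`), so the average fidelity is at most `(s √d₊ + s √d₋) / d⁴ = s² / d⁴`
(`averageFidelity_le`). A sequential network is a one-slot network, with Choi operator the link
product of those of its two channels (`isNetwork_seqNetwork`, `insertGate_seqNetwork`), so the
bound covers both classes.

*The decomposition.* It is proved as a statement on commutants
(`exists_eq_of_commute_mixedTensor`). An operator `X` commuting with all `U ⊗ U ⊗ U*` preserves
weights, hence acts as a scalar `l` on the highest weight vector `e₀ ⊗ e₀ ⊗ e₁*`, respectively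
`(e₀ ⊗ e₁ - e₁ ⊗ e₀) ⊗ e₂*`, and so on its orbit, which consists of the vectors `u ⊗ u ⊗ v*`,
respectively `(u ⊗ v - v ⊗ u) ⊗ w*`, for orthonormal families. The tensors annihilating the orbit
are the symmetrizations or antisymmetrizations of `x ⊗ δ` (`exists_eq_of_sym`,
`exists_eq_of_antisym`), so `X - l` lives on the copy of `H`, where it is a scalar by Schur's lemma
for the defining representation.

*Attainment.* The Kraus operators of the optimal network with the gate `U` inserted are
`∑ᵢ √(d / dᵢ) Pᵢ (U ⊗ |w⟩⟨z|) Pᵢ`, whose overlap with `U ⊗ U` is `(s / √d) ⟨w|U|z⟩*`; the squares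
add up to `s²` for every `U` (`channelFidelity_seqChannel`).
-/

namespace UnitaryCloning

open Matrix

/-! ### Kraus decompositions, Choi operators and channel fidelities -/

section Kraus

variable {n m l ι : Type}

theorem IsCompletelyPositive.comp {Ψ : Op m →ₗ[ℂ] Op l} {Φ : Op n →ₗ[ℂ] Op m}
    (hΨ : IsCompletelyPositive Ψ) (hΦ : IsCompletelyPositive Φ) :
    IsCompletelyPositive (Ψ ∘ₗ Φ) :=
  fun k X hX => hΨ k _ (hΦ k X hX)

theorem IsChannel.comp [Fintype n] [Fintype m] [Fintype l] {Ψ : Op m →ₗ[ℂ] Op l}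
    {Φ : Op n →ₗ[ℂ] Op m} (hΨ : IsChannel Ψ) (hΦ : IsChannel Φ) : IsChannel (Ψ ∘ₗ Φ) :=
  ⟨hΨ.1.comp hΦ.1, fun X => (hΨ.2 _).trans (hΦ.2 X)⟩

theorem tensorId_eq_sum_kraus [Fintype n] [Fintype ι] {k : Type} [Fintype k] [DecidableEq k]
    {Φ : Op n →ₗ[ℂ] Op m} (K : ι → Matrix m n ℂ) (h : ∀ X, Φ X = ∑ r, K r * X * (K r)ᴴ)
    (X : Op (n × k)) :
    tensorId k Φ X = ∑ r, (K r ⊗ₖ (1 : Op k)) * X * (K r ⊗ₖ (1 : Op k))ᴴ := by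
  ext ⟨a, i⟩ ⟨b, j⟩
  simp only [tensorId, LinearMap.coe_mk, AddHom.coe_mk, of_apply, h, Matrix.sum_apply]
  refine Finset.sum_congr rfl fun r _ => ?_
  simp [Matrix.mul_apply, Fintype.sum_prod_type, kroneckerMap_apply, Matrix.one_apply,
    Finset.sum_mul, apply_ite (starRingEnd ℂ)]

theorem isCompletelyPositive_of_kraus [Fintype n] [Fintype m] [Fintype ι]
    {Φ : Op n →ₗ[ℂ] Op m} (K : ι → Matrix m n ℂ) (h : ∀ X, Φ X = ∑ r, K r * X * (K r)ᴴ) :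
    IsCompletelyPositive Φ := by
  intro k X hX
  rw [tensorId_eq_sum_kraus K h]
  exact posSemidef_sum _ fun r _ => hX.mul_mul_conjTranspose_same _

theorem isChannel_of_kraus [Fintype n] [DecidableEq n] [Fintype m] [Fintype ι]
    {Φ : Op n →ₗ[ℂ] Op m} (K : ι → Matrix m n ℂ) (h : ∀ X, Φ X = ∑ r, K r * X * (K r)ᴴ)
    (hK : ∑ r, (K r)ᴴ * K r = 1) : IsChannel Φ := by
  refine ⟨isCompletelyPositive_of_kraus K h, fun X => ?_⟩
  rw [h, trace_sum]
  simp_rw [Matrix.mul_assoc, trace_mul_comm (K _), Matrix.mul_assoc]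
  rw [← trace_sum, ← Finset.mul_sum, hK, Matrix.mul_one]

theorem choi_apply [DecidableEq n] (Φ : Op n →ₗ[ℂ] Op m) (p q : m × n) :
    choi Φ p q = Φ (single p.2 q.2 1) p.1 q.1 := by
  have e : (of fun i j => vecMulVec (maxEntangled n) (star (maxEntangled n)) (i, p.2) (j, q.2))
      = (single p.2 q.2 1 : Op n) := by
    ext i j
    by_cases hi : i = p.2 <;> by_cases hj : j = q.2 <;>
      simp [vecMulVec_apply, maxEntangled, hi, hj, eq_comm]
  rw [← e]
  rfl

theorem choi_unitaryChannel_apply [Fintype n] [DecidableEq n] (V : Op n) (p q : n × n) :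
    choi (unitaryChannel V) p q = V p.1 p.2 * star (V q.1 q.2) := by
  rw [choi_apply]
  simp [unitaryChannel, Matrix.mul_apply, single_apply, ite_and]

theorem mul_single_mul_conjTranspose_apply [Fintype n] [DecidableEq n] (K : Matrix m n ℂ)
    (a b : m) (i j : n) : (K * single i j (1 : ℂ) * Kᴴ) a b = K a i * star (K b j) := by
  simp [Matrix.mul_apply, single_apply, ite_and]

/-- The channel fidelity of `X ↦ ∑ᵣ Kᵣ X Kᵣ†` with `V` is `∑ᵣ |Tr(V† Kᵣ)|² / D²`. -/
theorem channelFidelity_of_kraus [Fintype n] [DecidableEq n] [Fintype ι]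
    {Φ : Op n →ₗ[ℂ] Op n} (K : ι → Op n) (h : ∀ X, Φ X = ∑ r, K r * X * (K r)ᴴ) (V : Op n) :
    channelFidelity (choi Φ) V = (∑ r, ‖(Vᴴ * K r).trace‖ ^ 2) / (Fintype.card n : ℝ) ^ 2 := by
  unfold channelFidelity
  congr 1
  have key : (choi Φ * choi (unitaryChannel V)).trace
      = ((∑ r, ‖(Vᴴ * K r).trace‖ ^ 2 : ℝ) : ℂ) := by
    have e : ∀ r, (Vᴴ * K r).trace = ∑ p : n × n, star (V p.1 p.2) * K r p.1 p.2 := fun r => by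
      rw [Fintype.sum_prod_type_right]
      simp [trace, Matrix.mul_apply]
    push_cast
    simp_rw [← Complex.mul_conj', e, trace, diag_apply, Matrix.mul_apply, choi_apply,
      unitaryChannel, h, Matrix.sum_apply, mul_single_mul_conjTranspose_apply]
    simp only [LinearMap.coe_mk, AddHom.coe_mk, mul_single_mul_conjTranspose_apply,
      Finset.sum_mul, map_sum, Finset.mul_sum]
    rw [Finset.sum_comm_cycle]
    refine Finset.sum_congr rfl fun r _ => ?_
    rw [Finset.sum_comm]
    refine Finset.sum_congr rfl fun p _ => Finset.sum_congr rfl fun q _ => ?_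
    simp
    ring
  rw [key, Complex.ofReal_re]

end Kraus

/-! ### The symmetric and the antisymmetric subspace -/

section Projections

variable {d : ℕ}

/-- The eigenvalue of the swap operator on the symmetric (index `0`) and on the antisymmetric
(index `1`) subspace. -/
def swapSign : Fin 2 → ℝ := ![1, -1]

theorem swapSign_mul_self (i : Fin 2) : swapSign i * swapSign i = 1 := by
  fin_cases i <;> simp [swapSign]

theorem proj_eq (i : Fin 2) :
    proj d i = (1 / 2 : ℂ) • (1 + (swapSign i : ℂ) • swapOp d) := by
  fin_cases i <;> simp [swapSign, proj, sub_eq_add_neg]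

theorem projDim_eq (i : Fin 2) : projDim d i = d * (d + swapSign i) / 2 := by
  fin_cases i <;> simp [swapSign, projDim, sub_eq_add_neg]

theorem swapOp_mul_apply {k : Type} (X : Matrix (Pair d) k ℂ) (p : Pair d) (q : k) :
    (swapOp d * X) p q = X p.swap q := by
  rw [Matrix.mul_apply, Finset.sum_eq_single p.swap]
  · simp [swapOp]
  · rintro ⟨b, c⟩ - hb
    have : ¬ (p.1 = c ∧ p.2 = b) := fun h => hb (by ext <;> simp [h.1, h.2])
    simp [swapOp, this]
  · simp

theorem swapOp_transpose : (swapOp d)ᵀ = swapOp d := by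
  ext p q
  simp [swapOp, eq_comm, and_comm]

theorem swapOp_conjTranspose : (swapOp d)ᴴ = swapOp d := by
  ext p q
  simp [swapOp, conjTranspose_apply, eq_comm, and_comm, apply_ite (star : ℂ → ℂ)]

theorem mul_swapOp_apply {k : Type} (X : Matrix k (Pair d) ℂ) (p : k) (q : Pair d) :
    (X * swapOp d) p q = X p q.swap := by
  rw [← transpose_apply (X * swapOp d), transpose_mul, swapOp_transpose, swapOp_mul_apply,
    transpose_apply]

theorem swapOp_mul_swapOp : swapOp d * swapOp d = 1 := by
  ext p q
  rw [swapOp_mul_apply]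
  simp [swapOp, Matrix.one_apply, Prod.ext_iff, and_comm]

theorem swapOp_mul_kronecker_self (U : Op (Fin d)) :
    swapOp d * (U ⊗ₖ U) = (U ⊗ₖ U) * swapOp d := by
  ext p q
  rw [swapOp_mul_apply, mul_swapOp_apply]
  simp [kroneckerMap_apply, mul_comm]

theorem proj_conjTranspose (i : Fin 2) : (proj d i)ᴴ = proj d i := by
  simp [proj_eq, conjTranspose_smul, swapOp_conjTranspose, -one_div]

theorem proj_transpose (i : Fin 2) : (proj d i)ᵀ = proj d i := by
  simp [proj_eq, transpose_smul, swapOp_transpose, -one_div]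

theorem proj_mul_self (i : Fin 2) : proj d i * proj d i = proj d i := by
  have h : (swapSign i : ℂ) * swapSign i = 1 := by exact_mod_cast swapSign_mul_self i
  simp only [proj_eq, Matrix.smul_mul, Matrix.mul_smul, Matrix.add_mul, Matrix.mul_add,
    Matrix.one_mul, Matrix.mul_one, swapOp_mul_swapOp, smul_smul, smul_add]
  match_scalars
  · linear_combination (1 / 4) * h
  · ring

theorem proj_mul_of_ne {i j : Fin 2} (hij : i ≠ j) : proj d i * proj d j = 0 := by
  have h : (swapSign i : ℂ) = - swapSign j ∧ (swapSign j : ℂ) * swapSign j = 1 := by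
    fin_cases i <;> fin_cases j <;> simp_all [swapSign]
  simp only [proj_eq, Matrix.smul_mul, Matrix.mul_smul, Matrix.add_mul, Matrix.mul_add,
    Matrix.one_mul, Matrix.mul_one, swapOp_mul_swapOp, smul_smul, smul_add, h.1, mul_neg]
  match_scalars
  · linear_combination -(1 / 4) * h.2
  · ring

theorem sum_proj : ∑ i, proj d i = 1 := by
  simp only [Fin.sum_univ_two, proj_eq, swapSign]
  simp only [cons_val_zero, cons_val_one, Complex.ofReal_one, Complex.ofReal_neg]
  module

theorem proj_mul_kronecker_self (i : Fin 2) (U : Op (Fin d)) :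
    proj d i * (U ⊗ₖ U) = (U ⊗ₖ U) * proj d i := by
  simp [proj_eq, Matrix.add_mul, Matrix.mul_add, swapOp_mul_kronecker_self]

theorem proj_apply (i : Fin 2) (a b x y : Fin d) :
    proj d i (a, b) (x, y) = 1 / 2 * ((if a = x ∧ b = y then 1 else 0)
      + swapSign i * (if a = y ∧ b = x then 1 else 0)) := by
  simp [proj_eq, swapOp, Matrix.one_apply]

theorem sum_proj_apply_right (i : Fin 2) (a b : Fin d) :
    ∑ z, proj d i (a, z) (b, z) = (projDim d i / d : ℝ) * (1 : Op (Fin d)) a b := by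
  have hd : (d : ℂ) ≠ 0 := by
    have := a.pos
    exact_mod_cast this.ne'
  simp only [proj_apply, Matrix.one_apply, projDim_eq, ite_and, Finset.sum_add_distrib,
    ← Finset.mul_sum]
  push_cast
  by_cases h : a = b
  · subst h
    simp
    field_simp
  · have h' : ∀ z : Fin d, a = z → z ≠ b := fun z hz hb => h (hz.trans hb)
    simp [h]

theorem projDim_pos (hd : 2 ≤ d) (i : Fin 2) : 0 < projDim d i := by
  have : (2 : ℝ) ≤ d := by exact_mod_cast hd
  fin_cases i <;> simp [projDim] <;> nlinarith

theorem trace_proj (i : Fin 2) : (proj d i).trace = projDim d i := by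
  simp only [trace, diag_apply, Fintype.sum_prod_type, sum_proj_apply_right]
  rcases Nat.eq_zero_or_pos d with rfl | h
  · simp [projDim_eq]
  · have hd : (d : ℂ) ≠ 0 := by exact_mod_cast h.ne'
    simp
    field_simp

end Projections

/-! ### The optimal pre- and post-processing -/

section OptimalNetwork

variable {d : ℕ}

theorem sum_proj_apply_left (i : Fin 2) (a b : Fin d) :
    ∑ z, proj d i (z, a) (z, b) = (projDim d i / d : ℝ) * (1 : Op (Fin d)) a b := by
  rw [← sum_proj_apply_right]
  refine Finset.sum_congr rfl fun z _ => ?_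
  simp only [proj_apply, and_comm]

variable (d) in
/-- The Kraus operators `(I ⊗ ⟨z|) (P₊ ⊗ |+⟩ + P₋ ⊗ |-⟩)` of the pre-processing. -/
noncomputable def preKraus (z : Fin d) : Matrix (Fin d × Fin 2) (Pair d) ℂ :=
  of fun p q => proj d p.2 (p.1, z) q

variable (d) in
/-- The Kraus operators `∑ᵢ √(d / dᵢ) Pᵢ (⟨i| ⊗ |w⟩)` of the post-processing. -/
noncomputable def postKraus (w : Fin d) : Matrix (Pair d) (Fin d × Fin 2) ℂ :=
  of fun p q => ((√(d / projDim d q.2) : ℝ) : ℂ) * proj d q.2 p (q.1, w)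

theorem preChannel_apply (ρ : Op (Pair d)) (a b : Fin d) (i j : Fin 2) :
    preChannel d ρ (a, i) (b, j) = partialTraceRight (proj d i * ρ * proj d j) a b := by
  simp only [preChannel, LinearMap.coe_mk, AddHom.coe_mk, Matrix.sum_apply, kroneckerMap_apply,
    single_apply, ite_and, mul_ite, mul_one, mul_zero]
  simp

theorem preChannel_eq_sum_kraus (ρ : Op (Pair d)) :
    preChannel d ρ = ∑ z, preKraus d z * ρ * (preKraus d z)ᴴ := by
  ext ⟨a, i⟩ ⟨b, j⟩
  rw [preChannel_apply, Matrix.sum_apply]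
  simp only [partialTraceRight, LinearMap.coe_mk, AddHom.coe_mk, of_apply]
  refine Finset.sum_congr rfl fun z _ => ?_
  have h : ∀ q, star (proj d j (b, z) q) = proj d j q (b, z) := fun q => by
    rw [← conjTranspose_apply, proj_conjTranspose]
  simp only [Matrix.mul_apply, conjTranspose_apply, preKraus, of_apply, h]

theorem isChannel_preChannel : IsChannel (preChannel d) := by
  refine isChannel_of_kraus _ preChannel_eq_sum_kraus ?_
  rw [← sum_proj]
  ext p q
  have h : ∀ i r, star (proj d i r p) = proj d i p r := fun i r => by
    rw [← conjTranspose_apply, proj_conjTranspose]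
  simp only [Matrix.sum_apply, Matrix.mul_apply, conjTranspose_apply, preKraus, of_apply, h,
    Fintype.sum_prod_type]
  have h2 : ∀ i, proj d i p q = ∑ a, ∑ z, proj d i p (a, z) * proj d i (a, z) q := fun i => by
    conv_lhs => rw [← proj_mul_self i, Matrix.mul_apply, Fintype.sum_prod_type]
  simp only [h2]
  rw [Finset.sum_comm_cycle]
  exact Finset.sum_congr rfl fun i _ => Finset.sum_comm

theorem projDim_nonneg (i : Fin 2) : 0 ≤ projDim d i := by
  rcases Nat.eq_zero_or_pos d with rfl | h
  · simp [projDim_eq]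
  · have : (1 : ℝ) ≤ d := by exact_mod_cast h
    fin_cases i <;> simp [projDim] <;> nlinarith

theorem sqrt_div_mul_sqrt_div (i j : Fin 2) :
    √(d / projDim d i) * √(d / projDim d j) = d / √(projDim d i * projDim d j) := by
  rw [Real.sqrt_div (Nat.cast_nonneg d), Real.sqrt_div (Nat.cast_nonneg d),
    Real.sqrt_mul (projDim_nonneg i), div_mul_div_comm, Real.mul_self_sqrt (Nat.cast_nonneg d)]

theorem postChannel_eq_sum_kraus (σ : Op (Fin d × Fin 2)) :
    postChannel d σ = ∑ w, postKraus d w * σ * (postKraus d w)ᴴ := by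
  ext p q
  have h : ∀ j r, star (proj d j q r) = proj d j r q := fun j r => by
    rw [← conjTranspose_apply, proj_conjTranspose]
  have hs : ∀ x : ℝ, star (x : ℂ) = x := Complex.conj_ofReal
  simp only [postChannel, LinearMap.coe_mk, AddHom.coe_mk, Matrix.sum_apply, Matrix.smul_apply,
    Matrix.mul_apply, conjTranspose_apply, postKraus, of_apply, star_mul', h, hs,
    Fintype.sum_prod_type, kroneckerMap_apply, Matrix.one_apply, mul_ite, mul_one, mul_zero,
    Finset.sum_ite_eq', Finset.mem_univ, if_true, memBlock,
    ← sqrt_div_mul_sqrt_div, smul_eq_mul, Finset.mul_sum, Finset.sum_mul]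
  -- both sides are the same sum over `(i, j, a, b, w)`; collect it over a product type
  simp only [← Fintype.sum_prod_type']
  refine Fintype.sum_equiv
    { toFun := fun x : Fin 2 × Fin 2 × Fin d × Fin d × Fin d =>
        (x.2.2.2.1, x.2.2.1, x.2.1, x.2.2.2.2, x.1)
      invFun := fun y => (y.2.2.2.2, y.2.2.1, y.2.1, y.1, y.2.2.2.1)
      left_inv := fun _ => rfl
      right_inv := fun _ => rfl } _ _ fun x => ?_
  simp only [Equiv.coe_fn_mk]
  push_cast
  ring

theorem isChannel_postChannel (hd : 2 ≤ d) : IsChannel (postChannel d) := by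
  refine isChannel_of_kraus _ postChannel_eq_sum_kraus ?_
  ext ⟨a, i⟩ ⟨b, j⟩
  have h : ∀ i r s, star (proj d i r s) = proj d i s r := fun i r s => by
    rw [← conjTranspose_apply, proj_conjTranspose]
  have hs : ∀ x : ℝ, star (x : ℂ) = x := Complex.conj_ofReal
  have hd0 : (d : ℝ) ≠ 0 := by positivity
  have h1 : (∑ w, (postKraus d w)ᴴ * postKraus d w) (a, i) (b, j)
      = ((√(d / projDim d i) * √(d / projDim d j) : ℝ) : ℂ)
        * ∑ w, (proj d i * proj d j) (a, w) (b, w) := by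
    simp only [Matrix.sum_apply, Matrix.mul_apply, conjTranspose_apply, postKraus, of_apply,
      star_mul', h, hs, Finset.mul_sum]
    refine Finset.sum_congr rfl fun w _ => Finset.sum_congr rfl fun p _ => ?_
    push_cast
    ring
  rw [h1]
  by_cases hij : i = j
  · subst hij
    have := (projDim_pos hd i).ne'
    rw [proj_mul_self, sum_proj_apply_right, ← mul_assoc, ← Complex.ofReal_mul,
      Real.mul_self_sqrt (div_nonneg (Nat.cast_nonneg d) (projDim_nonneg i)),
      div_mul_div_cancel₀ this, div_self hd0]
    simp [Matrix.one_apply]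
  · simp [proj_mul_of_ne hij, hij]

theorem isChannel_tensorId_unitaryChannel (m : ℕ) {U : Op (Fin d)}
    (hU : U ∈ unitaryGroup (Fin d) ℂ) : IsChannel (tensorId (Fin m) (unitaryChannel U)) := by
  refine isChannel_of_kraus (ι := Unit) (fun _ => U ⊗ₖ (1 : Op (Fin m))) (fun X => ?_) ?_
  · rw [tensorId_eq_sum_kraus (ι := Unit) (fun _ => U) (by simp [unitaryChannel])]
  · rw [mem_unitaryGroup_iff', star_eq_conjTranspose] at hU
    simp [conjTranspose_kronecker, ← mul_kronecker_mul, hU]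

theorem isChannel_seqChannel {m : ℕ} {A : Op (Pair d) →ₗ[ℂ] Op (Fin d × Fin m)}
    {B : Op (Fin d × Fin m) →ₗ[ℂ] Op (Pair d)} (hA : IsChannel A) (hB : IsChannel B)
    {U : Op (Fin d)} (hU : U ∈ unitaryGroup (Fin d) ℂ) : IsChannel (seqChannel A B U) :=
  hB.comp ((isChannel_tensorId_unitaryChannel m hU).comp hA)

theorem seqChannel_eq_sum_kraus (U : Op (Fin d)) (ρ : Op (Pair d)) :
    seqChannel (preChannel d) (postChannel d) U ρ
      = ∑ r : Fin d × Fin d, (postKraus d r.1 * (U ⊗ₖ (1 : Op (Fin 2))) * preKraus d r.2) * ρ *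
        (postKraus d r.1 * (U ⊗ₖ (1 : Op (Fin 2))) * preKraus d r.2)ᴴ := by
  simp only [seqChannel, LinearMap.comp_apply, postChannel_eq_sum_kraus]
  rw [Fintype.sum_prod_type, tensorId_eq_sum_kraus (ι := Unit) (fun _ => U)
    (by simp [unitaryChannel]), preChannel_eq_sum_kraus]
  simp [Matrix.mul_sum, Matrix.sum_mul, Matrix.mul_assoc, conjTranspose_mul]

theorem seqChannel_apply (U : Op (Fin d)) (ρ : Op (Pair d)) :
    seqChannel (preChannel d) (postChannel d) U ρ
      = ∑ i : Fin 2, ∑ j : Fin 2, (((d : ℝ) / √(projDim d i * projDim d j) : ℝ) : ℂ) •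
          (proj d i * ((U * partialTraceRight (proj d i * ρ * proj d j) * U.conjTranspose)
            ⊗ₖ (1 : Op (Fin d))) * proj d j) := by
  have h : ∀ i j, memBlock d i j (tensorId (Fin 2) (unitaryChannel U) (preChannel d ρ))
      = U * partialTraceRight (proj d i * ρ * proj d j) * Uᴴ := fun i j => by
    ext a b
    simp only [memBlock, tensorId, LinearMap.coe_mk, AddHom.coe_mk, of_apply, unitaryChannel,
      preChannel_apply]
    rfl
  simp only [seqChannel, LinearMap.comp_apply, postChannel, LinearMap.coe_mk, AddHom.coe_mk, h]

theorem trace_proj_mul_one_kronecker (i : Fin 2) (M : Op (Fin d)) :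
    (proj d i * ((1 : Op (Fin d)) ⊗ₖ M)).trace = (projDim d i / d : ℝ) * M.trace := by
  have h : (proj d i * ((1 : Op (Fin d)) ⊗ₖ M)).trace
      = ∑ b, ∑ y, (∑ a, proj d i (a, b) (a, y)) * M y b := by
    have e : ∀ a b, (proj d i * ((1 : Op (Fin d)) ⊗ₖ M)) (a, b) (a, b)
        = ∑ y, proj d i (a, b) (a, y) * M y b := fun a b => by
      rw [Matrix.mul_apply, Fintype.sum_prod_type_right]
      simp [Matrix.one_apply]
    simp only [trace, diag_apply, Fintype.sum_prod_type_right, e, Finset.sum_mul]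
    exact Finset.sum_congr rfl fun b _ => Finset.sum_comm
  rw [h]
  simp only [sum_proj_apply_left, Matrix.one_apply, mul_ite, mul_one, mul_zero, ite_mul,
    zero_mul, Finset.sum_ite_eq, Finset.mem_univ, if_true, trace, diag_apply, Finset.mul_sum]

/-- The Kraus operators of the optimal network with the gate `U` inserted. -/
theorem postKraus_mul_mul_preKraus (U : Op (Fin d)) (w z : Fin d) :
    postKraus d w * (U ⊗ₖ (1 : Op (Fin 2))) * preKraus d z
      = ∑ i, ((√(d / projDim d i) : ℝ) : ℂ) •
          (proj d i * (U ⊗ₖ single w z (1 : ℂ)) * proj d i) := by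
  ext p q
  have e : ∀ i, (proj d i * (U ⊗ₖ single w z (1 : ℂ)) * proj d i) p q
      = ∑ b, ∑ a, proj d i p (a, w) * U a b * proj d i (b, z) q := fun i => by
    simp [Matrix.mul_apply, Fintype.sum_prod_type, single_apply, ite_and, Finset.sum_ite_irrel,
      Finset.sum_mul]
  simp only [Matrix.sum_apply, Matrix.smul_apply, smul_eq_mul, e]
  simp only [Matrix.mul_apply, postKraus, preKraus, of_apply, Fintype.sum_prod_type,
    kroneckerMap_apply, Matrix.one_apply, mul_ite, mul_one, mul_zero, Finset.sum_ite_eq',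
    Finset.mem_univ, if_true, Finset.sum_mul, Finset.mul_sum]
  rw [Finset.sum_comm]
  simp only [mul_assoc]

theorem cloneFidelity_eq (hd : 2 ≤ d) :
    cloneFidelity d = (√(projDim d 0) + √(projDim d 1)) ^ 2 / (d : ℝ) ^ 4 := by
  have h2 : (2 : ℝ) ≤ d := by exact_mod_cast hd
  have h : √(projDim d 0) * √(projDim d 1) = d * √((d : ℝ) ^ 2 - 1) / 2 := by
    rw [← Real.sqrt_mul (projDim_nonneg 0)]
    have : projDim d 0 * projDim d 1 = (d / 2) ^ 2 * ((d : ℝ) ^ 2 - 1) := by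
      simp [projDim]; ring
    rw [this, Real.sqrt_mul (by positivity), Real.sqrt_sq (by positivity)]
    ring
  have h' : projDim d 0 + projDim d 1 = (d : ℝ) ^ 2 := by simp [projDim]; ring
  have e : (√(projDim d 0) + √(projDim d 1)) ^ 2 = (d : ℝ) ^ 2 + d * √((d : ℝ) ^ 2 - 1) := by
    rw [add_sq, Real.sq_sqrt (projDim_nonneg 0), Real.sq_sqrt (projDim_nonneg 1), mul_assoc, h,
      ← h']
    ring
  rw [e, cloneFidelity]
  have : (d : ℝ) ≠ 0 := by positivity
  field_simp

theorem sum_sqrt_mul_projDim :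
    ∑ i, √(d / projDim d i) * (projDim d i / d) = (√(projDim d 0) + √(projDim d 1)) / √d := by
  have h : ∀ i, √(d / projDim d i) * (projDim d i / d) = √(projDim d i) / √d := fun i => by
    rw [Real.sqrt_div (Nat.cast_nonneg d), div_mul_div_comm,
      mul_comm √(d : ℝ), ← div_mul_div_comm, Real.div_sqrt, Real.sqrt_div_self', mul_one_div]
  rw [Fin.sum_univ_two, h, h, add_div]

theorem sum_norm_sq_unitary {U : Op (Fin d)} (hU : U ∈ unitaryGroup (Fin d) ℂ) :
    ∑ r : Fin d × Fin d, ‖U r.1 r.2‖ ^ 2 = d := by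
  rw [mem_unitaryGroup_iff, star_eq_conjTranspose] at hU
  have h := congrArg trace hU
  rw [trace_one, Fintype.card_fin] at h
  simp only [trace, diag_apply, Matrix.mul_apply, conjTranspose_apply] at h
  rw [Fintype.sum_prod_type]
  have e : ∀ x : ℂ, x * star x = ((‖x‖ ^ 2 : ℝ) : ℂ) := fun x => by
    push_cast; exact Complex.mul_conj' x
  simp only [e] at h
  exact_mod_cast h

theorem channelFidelity_seqChannel (hd : 2 ≤ d) {U : Op (Fin d)}
    (hU : U ∈ unitaryGroup (Fin d) ℂ) :
    channelFidelity (choi (seqChannel (preChannel d) (postChannel d) U)) (U ⊗ₖ U)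
      = cloneFidelity d := by
  have hU' : Uᴴ * U = 1 := by
    rwa [mem_unitaryGroup_iff', star_eq_conjTranspose] at hU
  rw [channelFidelity_of_kraus _ (seqChannel_eq_sum_kraus U), cloneFidelity_eq hd]
  have ht : ∀ w z, ((U ⊗ₖ U)ᴴ *
      (postKraus d w * (U ⊗ₖ (1 : Op (Fin 2))) * preKraus d z)).trace
      = (((√(projDim d 0) + √(projDim d 1)) / √d : ℝ) : ℂ) * star (U w z) := fun w z => by
    have hi : ∀ i, ((U ⊗ₖ U)ᴴ * (proj d i * (U ⊗ₖ single w z (1 : ℂ)) * proj d i)).trace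
        = (projDim d i / d : ℝ) * star (U w z) := fun i => by
      have hc : (U ⊗ₖ U)ᴴ * proj d i = proj d i * (U ⊗ₖ U)ᴴ := by
        have := congrArg conjTranspose (proj_mul_kronecker_self i U)
        rwa [conjTranspose_mul, conjTranspose_mul, proj_conjTranspose] at this
      rw [← Matrix.mul_assoc, ← Matrix.mul_assoc, hc, Matrix.mul_assoc (proj d i), trace_mul_comm,
        ← Matrix.mul_assoc, proj_mul_self, conjTranspose_kronecker, ← mul_kronecker_mul, hU',
        trace_proj_mul_one_kronecker]
      congr 1
      simp [trace_mul_single]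
    rw [postKraus_mul_mul_preKraus, Finset.mul_sum, trace_sum]
    simp only [Matrix.mul_smul, trace_smul, hi, smul_eq_mul, ← sum_sqrt_mul_projDim]
    push_cast
    simp only [Finset.sum_mul, mul_assoc]
  simp only [ht, norm_mul, mul_pow, ← Finset.mul_sum, norm_star, sum_norm_sq_unitary hU,
    Complex.norm_real, Real.norm_eq_abs, sq_abs]
  rw [div_pow, Real.sq_sqrt (Nat.cast_nonneg d)]
  have : (d : ℝ) ≠ 0 := by positivity
  simp
  field_simp

end OptimalNetwork

/-! ### The controlled swap -/

section ControlledSwap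

variable {d : ℕ}

theorem controlledSwap_apply (p q : Pair d) (i j : Fin 2) :
    controlledSwap d (p, i) (q, j)
      = 1 / 2 * ((1 : Op (Pair d)) p q + swapSign i * swapSign j * swapOp d p q) := by
  fin_cases i <;> fin_cases j <;> simp [controlledSwap, swapSign] <;> ring

theorem controlledSwap_mem_unitaryGroup :
    controlledSwap d ∈ unitaryGroup (Pair d × Fin 2) ℂ := by
  rw [mem_unitaryGroup_iff, star_eq_conjTranspose]
  have e1 : (((1 / 2 : ℂ) • !![1, 1; 1, 1] : Op (Fin 2)))ᴴ = (1 / 2 : ℂ) • !![1, 1; 1, 1] := by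
    ext i j; fin_cases i <;> fin_cases j <;> simp
  have e2 : (((1 / 2 : ℂ) • !![1, -1; -1, 1] : Op (Fin 2)))ᴴ
      = (1 / 2 : ℂ) • !![1, -1; -1, 1] := by
    ext i j; fin_cases i <;> fin_cases j <;> simp
  have e3 : ((1 / 2 : ℂ) • !![1, 1; 1, 1] : Op (Fin 2)) * ((1 / 2 : ℂ) • !![1, 1; 1, 1])
      = (1 / 2 : ℂ) • !![1, 1; 1, 1] := by
    ext i j; fin_cases i <;> fin_cases j <;> simp <;> norm_num
  have e4 : ((1 / 2 : ℂ) • !![1, -1; -1, 1] : Op (Fin 2)) * ((1 / 2 : ℂ) • !![1, -1; -1, 1])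
      = (1 / 2 : ℂ) • !![1, -1; -1, 1] := by
    ext i j; fin_cases i <;> fin_cases j <;> simp <;> norm_num
  have e5 : ((1 / 2 : ℂ) • !![1, 1; 1, 1] : Op (Fin 2)) * ((1 / 2 : ℂ) • !![1, -1; -1, 1])
      = 0 := by
    ext i j; fin_cases i <;> fin_cases j <;> simp
  have e6 : ((1 / 2 : ℂ) • !![1, -1; -1, 1] : Op (Fin 2)) * ((1 / 2 : ℂ) • !![1, 1; 1, 1])
      = 0 := by
    ext i j; fin_cases i <;> fin_cases j <;> simp
  have e7 : ((1 / 2 : ℂ) • !![1, 1; 1, 1] : Op (Fin 2)) + ((1 / 2 : ℂ) • !![1, -1; -1, 1])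
      = 1 := by
    ext i j; fin_cases i <;> fin_cases j <;> simp <;> norm_num
  rw [controlledSwap, conjTranspose_add, conjTranspose_kronecker, conjTranspose_kronecker, e1, e2,
    swapOp_conjTranspose, conjTranspose_one, Matrix.add_mul, Matrix.mul_add, Matrix.mul_add,
    ← mul_kronecker_mul, ← mul_kronecker_mul, ← mul_kronecker_mul, ← mul_kronecker_mul, e3, e4,
    e5, e6, swapOp_mul_swapOp, Matrix.one_mul, kronecker_zero, kronecker_zero, add_zero, zero_add,
    ← kronecker_add, e7, one_kronecker_one]

theorem preChannel_eq_controlledSwap (ρ : Op (Pair d)) :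
    preChannel d ρ = tensorId (Fin 2) partialTraceRight
      (controlledSwap d * (ρ ⊗ₖ single 0 0 (1 : ℂ)) * (controlledSwap d)ᴴ) := by
  have hV : ∀ p q i, controlledSwap d (p, i) (q, 0) = proj d i p q := fun p q i => by
    rw [controlledSwap_apply, proj_eq]
    simp [swapSign]
  ext ⟨a, i⟩ ⟨b, j⟩
  rw [preChannel_apply]
  simp only [partialTraceRight, tensorId, LinearMap.coe_mk, AddHom.coe_mk, of_apply]
  refine Finset.sum_congr rfl fun z _ => ?_
  have h : ∀ q, star (proj d j (b, z) q) = proj d j q (b, z) := fun q => by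
    rw [← conjTranspose_apply, proj_conjTranspose]
  simp only [Matrix.mul_apply, 
    Fintype.sum_prod_type (α₁ := Pair d) (α₂ := Fin 2), Fin.sum_univ_two, conjTranspose_apply,
    kroneckerMap_apply]
  simp [hV, ← h]

end ControlledSwap

/-! ### Sequential networks as one-slot networks -/

section SequentialNetwork

variable {n m k : Type}

/-- Complete positivity is stated with ancillas `Fin k`; here the ancilla is a copy of the input. -/
theorem posSemidef_choi [Fintype n] [DecidableEq n] {Φ : Op n →ₗ[ℂ] Op m}
    (hΦ : IsCompletelyPositive Φ) : (choi Φ).PosSemidef := by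
  let e := Fintype.equivFin n
  let v : n × Fin (Fintype.card n) → ℂ := fun p => maxEntangled n (p.1, e.symm p.2)
  have h := (hΦ _ _ (posSemidef_vecMulVec_self_star v)).submatrix (Prod.map id e)
  convert h using 1
  ext p q
  simp [choi, tensorId, v, vecMulVec_apply]

/-- A linear map is recovered from its Choi operator. -/
theorem apply_eq_sum_choi [Fintype n] [DecidableEq n] (Φ : Op n →ₗ[ℂ] Op m) (Y : Op n) (a b : m) :
    Φ Y a b = ∑ s, ∑ t, Y s t * choi Φ (a, s) (b, t) := by
  conv_lhs => rw [matrix_eq_sum_single Y]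
  simp only [map_sum, Matrix.sum_apply, choi_apply]
  refine Finset.sum_congr rfl fun s _ => Finset.sum_congr rfl fun t _ => ?_
  have : single s t (Y s t) = Y s t • (single s t 1 : Op n) := by simp [smul_single]
  rw [this, map_smul, Matrix.smul_apply, smul_eq_mul]

/-- Compression by the vector `∑ᵢ |i⟩` of the second factor. -/
theorem posSemidef_sum_blocks [Fintype n] [DecidableEq n] [Fintype k] {G : Op (n × k)}
    (hG : G.PosSemidef) : (of fun x y => ∑ i, ∑ j, G (x, i) (y, j) : Op n).PosSemidef := by
  let K : Matrix n (n × k) ℂ := of fun x p => if x = p.1 then 1 else 0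
  convert hG.mul_mul_conjTranspose_same K using 1
  ext x y
  simp only [K, Matrix.mul_apply, Fintype.sum_prod_type_right, of_apply, conjTranspose_apply]
  rw [Finset.sum_comm]
  simp

theorem posSemidef_sum_diag_blocks [Fintype k] {G : Op (n × k)}
    (hG : G.PosSemidef) : (of fun x y => ∑ i, G (x, i) (y, i) : Op n).PosSemidef := by
  have : (of fun x y => ∑ i, G (x, i) (y, i) : Op n)
      = ∑ i, G.submatrix (fun x => (x, i)) (fun x => (x, i)) := by
    ext x y
    simp [Matrix.sum_apply]
  rw [this]
  exact posSemidef_sum _ fun i _ => hG.submatrix _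

variable {d M : ℕ}

/-- The Choi operator of the network obtained by wiring the memory outputs of `A` to the memory
inputs of `B` (the link product of the Choi operators of `A` and `B`). -/
noncomputable def seqNetwork (A : Op (Pair d) →ₗ[ℂ] Op (Fin d × Fin M))
    (B : Op (Fin d × Fin M) →ₗ[ℂ] Op (Pair d)) : Op (NetIdx d) :=
  of fun x y => ∑ i, ∑ j, choi A ((x.2.1, i), x.1) ((y.2.1, j), y.1) *
    choi B (x.2.2.2, (x.2.2.1, i)) (y.2.2.2, (y.2.2.1, j))

theorem isNetwork_seqNetwork {A : Op (Pair d) →ₗ[ℂ] Op (Fin d × Fin M)}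
    {B : Op (Fin d × Fin M) →ₗ[ℂ] Op (Pair d)} (hA : IsChannel A) (hB : IsChannel B) :
    IsNetwork (seqNetwork A B) := by
  have hA' := posSemidef_choi hA.1
  have hB' := posSemidef_choi hB.1
  refine ⟨?_, of fun x y => ∑ i, choi A ((x.2, i), x.1) ((y.2, i), y.1), ?_, ?_, ?_⟩
  · -- an entrywise (Schur) product of non-negative operators, compressed on the memory
    have h := posSemidef_sum_blocks
      ((hA'.submatrix fun p : NetIdx d × Fin M => ((p.1.2.1, p.2), p.1.1)).hadamard
        (hB'.submatrix fun p : NetIdx d × Fin M => (p.1.2.2.2, (p.1.2.2.1, p.2))))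
    simp only [hadamard_apply, submatrix_apply] at h
    exact h
  · have h := posSemidef_sum_diag_blocks
      (hA'.submatrix fun p : (Pair d × Fin d) × Fin M => ((p.1.2, p.2), p.1.1))
    simp only [submatrix_apply] at h
    exact h
  · intro x0 x1 x2 y0 y1 y2
    have hB2 : ∀ i j, ∑ x3 : Pair d, choi B (x3, (x2, i)) (x3, (y2, j))
        = (1 : Op (Fin d)) x2 y2 * (1 : Op (Fin M)) i j := fun i j => by
      have := hB.2 (single (x2, i) (y2, j) 1)
      simp only [choi_apply]
      refine this.trans ?_
      by_cases h : x2 = y2 <;> by_cases h' : i = j <;> simp [h, h', Matrix.one_apply, trace]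
    simp only [seqNetwork, of_apply]
    rw [Finset.mul_sum, Finset.sum_comm]
    refine Finset.sum_congr rfl fun i _ => ?_
    rw [Finset.sum_comm]
    simp only [← Finset.mul_sum, hB2]
    simp [Matrix.one_apply, mul_comm]
  · intro x0 y0
    have := hA.2 (single x0 y0 1)
    simp only [of_apply, choi_apply]
    rw [← Fintype.sum_prod_type']
    refine this.trans ?_
    by_cases h : x0 = y0 <;> simp [h, Matrix.one_apply, trace]

theorem insertGate_seqNetwork (A : Op (Pair d) →ₗ[ℂ] Op (Fin d × Fin M))
    (B : Op (Fin d × Fin M) →ₗ[ℂ] Op (Pair d)) (U : Op (Fin d)) :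
    insertGate (seqNetwork A B) (choi (unitaryChannel U)) = choi (seqChannel A B U) := by
  ext p q
  rw [choi_apply]
  simp only [seqChannel, LinearMap.comp_apply]
  rw [apply_eq_sum_choi B]
  simp only [insertGate, of_apply, choi_unitaryChannel_apply, seqNetwork, star_mul', star_star,
    choi_apply A]
  simp only [tensorId, LinearMap.coe_mk, AddHom.coe_mk, unitaryChannel, Matrix.mul_apply,
    conjTranspose_apply, Fintype.sum_prod_type, of_apply, Finset.sum_mul, Finset.mul_sum]
  simp only [← Fintype.sum_prod_type']
  refine Fintype.sum_equiv
    { toFun := fun x : Fin d × Fin d × Fin d × Fin d × Fin M × Fin M =>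
        (x.2.2.2.1, x.2.2.2.2.1, x.2.1, x.2.2.2.2.2, x.1, x.2.2.1)
      invFun := fun y => (y.2.2.2.2.1, y.2.2.1, y.2.2.2.2.2, y.1, y.2.1, y.2.2.2.1)
      left_inv := fun _ => rfl
      right_inv := fun _ => rfl } _ _ fun x => ?_
  simp only [Equiv.coe_fn_mk]
  ring

end SequentialNetwork

/-! ### The representation `U ⊗ U ⊗ U*` -/

section Representation

variable {d : ℕ}

/-- The operator `U ⊗ U ⊗ U*` on `H ⊗ H ⊗ H*`. -/
noncomputable def mixedTensor (U : Op (Fin d)) : Op (Pair d × Fin d) := (U ⊗ₖ U) ⊗ₖ U.map star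

variable (d) in
/-- The projector `P± ⊗ I` on `H ⊗ H ⊗ H*`. -/
noncomputable def mixedProj (i : Fin 2) : Op (Pair d × Fin d) := proj d i ⊗ₖ (1 : Op (Fin d))

variable (d) in
/-- The intertwiner `H → P± (H ⊗ H) ⊗ H*`, `x ↦ ∑_c (x ⊗ e_c ± e_c ⊗ x) ⊗ e_c*`. -/
noncomputable def embed (i : Fin 2) : Matrix (Pair d × Fin d) (Fin d) ℂ :=
  of fun p x => (if p.1.1 = x ∧ p.1.2 = p.2 then 1 else 0)
    + swapSign i * (if p.1.2 = x ∧ p.1.1 = p.2 then 1 else 0)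

theorem mixedTensor_apply (U : Op (Fin d)) (p q : Pair d × Fin d) :
    mixedTensor U p q = U p.1.1 q.1.1 * U p.1.2 q.1.2 * star (U p.2 q.2) := rfl

theorem mixedTensor_mul (U V : Op (Fin d)) :
    mixedTensor (U * V) = mixedTensor U * mixedTensor V := by
  have : (U * V).map star = U.map star * V.map star := by
    ext i j
    simp [Matrix.mul_apply]
  rw [mixedTensor, mixedTensor, mixedTensor, ← mul_kronecker_mul, ← mul_kronecker_mul, this]

theorem mixedTensor_one : mixedTensor (1 : Op (Fin d)) = 1 := by
  simp [mixedTensor]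

theorem mixedTensor_conjTranspose (U : Op (Fin d)) : (mixedTensor U)ᴴ = mixedTensor Uᴴ := by
  ext p q
  simp [mixedTensor_apply, conjTranspose_apply]

theorem conjTranspose_mul_mixedTensor {U : Op (Fin d)} (hU : U ∈ unitaryGroup (Fin d) ℂ) :
    (mixedTensor U)ᴴ * mixedTensor U = 1 := by
  rw [mem_unitaryGroup_iff', star_eq_conjTranspose] at hU
  rw [mixedTensor_conjTranspose, ← mixedTensor_mul, hU, mixedTensor_one]

theorem mixedProj_apply (i : Fin 2) (p q : Pair d × Fin d) :
    mixedProj d i p q = proj d i p.1 q.1 * (1 : Op (Fin d)) p.2 q.2 := rfl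

theorem mixedProj_mul_self (i : Fin 2) : mixedProj d i * mixedProj d i = mixedProj d i := by
  rw [mixedProj, ← mul_kronecker_mul, proj_mul_self, Matrix.one_mul]

theorem mixedProj_conjTranspose (i : Fin 2) : (mixedProj d i)ᴴ = mixedProj d i := by
  rw [mixedProj, conjTranspose_kronecker, proj_conjTranspose, conjTranspose_one]

theorem mixedProj_transpose (i : Fin 2) : (mixedProj d i)ᵀ = mixedProj d i := by
  rw [mixedProj, ← kroneckerMap_transpose, proj_transpose, transpose_one]

theorem sum_mixedProj : ∑ i, mixedProj d i = 1 := by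
  rw [Fin.sum_univ_two, mixedProj, mixedProj, ← add_kronecker, ← Fin.sum_univ_two, sum_proj,
    one_kronecker_one]

theorem trace_mixedProj (i : Fin 2) : (mixedProj d i).trace = projDim d i * d := by
  rw [mixedProj, trace_kronecker, trace_proj, trace_one, Fintype.card_fin]

theorem mixedProj_mul_mixedTensor (i : Fin 2) (U : Op (Fin d)) :
    mixedProj d i * mixedTensor U = mixedTensor U * mixedProj d i := by
  rw [mixedProj, mixedTensor, ← mul_kronecker_mul, ← mul_kronecker_mul,
    proj_mul_kronecker_self, Matrix.one_mul, Matrix.mul_one]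

theorem embed_apply (i : Fin 2) (a b c x : Fin d) :
    embed d i ((a, b), c) x = (if a = x ∧ b = c then 1 else 0)
      + swapSign i * (if b = x ∧ a = c then 1 else 0) := rfl

theorem mixedProj_mul_apply {k : Type} (i : Fin 2) (X : Matrix (Pair d × Fin d) k ℂ)
    (a b c : Fin d) (q : k) :
    (mixedProj d i * X) ((a, b), c) q
      = 1 / 2 * (X ((a, b), c) q + swapSign i * X ((b, a), c) q) := by
  simp [Matrix.mul_apply, mixedProj_apply, Fintype.sum_prod_type, Matrix.one_apply, proj_apply,
    mul_add, add_mul, Finset.sum_add_distrib, ite_and, Finset.sum_ite_irrel, mul_assoc]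

theorem mul_mixedProj_apply {k : Type} (i : Fin 2) (X : Matrix k (Pair d × Fin d) ℂ)
    (a b c : Fin d) (q : k) :
    (X * mixedProj d i) q ((a, b), c)
      = 1 / 2 * (X q ((a, b), c) + swapSign i * X q ((b, a), c)) := by
  rw [← transpose_apply (X * _), transpose_mul, mixedProj_transpose, mixedProj_mul_apply]
  rfl

theorem mixedProj_mul_embed (i : Fin 2) : mixedProj d i * embed d i = embed d i := by
  have h : (swapSign i : ℂ) * swapSign i = 1 := by exact_mod_cast swapSign_mul_self i
  ext ⟨⟨a, b⟩, c⟩ x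
  rw [mixedProj_mul_apply, embed_apply, embed_apply]
  linear_combination (1 / 2) * (if a = x ∧ b = c then 1 else 0) * h

theorem embed_conjTranspose_eq_transpose (i : Fin 2) : (embed d i)ᴴ = (embed d i)ᵀ := by
  ext x p
  simp [embed, conjTranspose_apply, apply_ite (starRingEnd ℂ)]

theorem embed_conjTranspose_mul_embed (i : Fin 2) :
    (embed d i)ᴴ * embed d i = (2 * (d + swapSign i) : ℂ) • (1 : Op (Fin d)) := by
  have h : (swapSign i : ℂ) * swapSign i = 1 := by exact_mod_cast swapSign_mul_self i
  ext x y
  rw [embed_conjTranspose_eq_transpose, Matrix.mul_apply]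
  simp only [transpose_apply, Fintype.sum_prod_type, embed_apply, mul_add, add_mul,
    Finset.sum_add_distrib]
  by_cases hxy : x = y
  · subst hxy
    simp [ite_and, Finset.sum_ite_irrel]
    linear_combination (d : ℂ) * h
  · have hyx : y ≠ x := fun h => hxy h.symm
    simp [ite_and, Finset.sum_ite_irrel, hxy, hyx]

theorem mixedTensor_mul_embed (i : Fin 2) {U : Op (Fin d)} (hU : U ∈ unitaryGroup (Fin d) ℂ) :
    mixedTensor U * embed d i = embed d i * U := by
  rw [mem_unitaryGroup_iff, star_eq_conjTranspose] at hU
  have hU' : ∀ b c, ∑ y, U b y * star (U c y) = (1 : Op (Fin d)) b c := fun b c => by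
    rw [← hU]; simp [Matrix.mul_apply]
  ext ⟨⟨a, b⟩, c⟩ x
  have e : (mixedTensor U * embed d i) ((a, b), c) x
      = U a x * (∑ y, U b y * star (U c y)) + swapSign i * (U b x * ∑ y, U a y * star (U c y)) := by
    simp only [Matrix.mul_apply, mixedTensor_apply, embed_apply, Fintype.sum_prod_type, mul_add,
      Finset.sum_add_distrib, Finset.mul_sum]
    congr 1
    · simp [ite_and, Finset.sum_ite_irrel, mul_assoc]
    · simp [ite_and, Finset.sum_ite_irrel]
      refine Finset.sum_congr rfl fun y _ => ?_
      ring
  rw [e, hU', hU', Matrix.mul_apply]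
  simp [embed_apply, Matrix.one_apply, add_mul, Finset.sum_add_distrib, ite_and]

/-- Vectors that are nonzero and pairwise orthogonal can be prescribed, up to scalar factors, as
columns of a unitary matrix. -/
theorem exists_unitary_columns (v : Fin d → Fin d → ℂ) (s : Set (Fin d))
    (h0 : ∀ i ∈ s, v i ≠ 0)
    (ho : ∀ i ∈ s, ∀ j ∈ s, i ≠ j → ∑ a, star (v i a) * v j a = 0) :
    ∃ U ∈ unitaryGroup (Fin d) ℂ, ∃ c : Fin d → ℂ, ∀ i ∈ s, c i ≠ 0 ∧ ∀ a, U a i = c i * v i a := by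
  let w : Fin d → EuclideanSpace ℂ (Fin d) := fun i => WithLp.toLp 2 (v i)
  let c : Fin d → ℂ := fun i => ((‖w i‖⁻¹ : ℝ) : ℂ)
  have hw : ∀ i ∈ s, w i ≠ 0 := fun i hi h => h0 i hi (by simpa [w] using h)
  have hon : Orthonormal ℂ (s.domRestrict fun i => c i • w i) := by
    constructor
    · rintro ⟨i, hi⟩
      have := norm_ne_zero_iff.mpr (hw i hi)
      simp [Set.domRestrict, c, norm_smul, this]
    · rintro ⟨i, hi⟩ ⟨j, hj⟩ hij
      have := ho i hi j hj (fun h => hij (Subtype.ext h))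
      simp only [Set.domRestrict_apply, inner_smul_left, inner_smul_right]
      have h2 : inner ℂ (w i) (w j) = 0 := by
        rw [← this]
        simp [w, PiLp.inner_apply, mul_comm]
      simp [h2]
  obtain ⟨b, hb⟩ := hon.exists_orthonormalBasis_extension_of_card_eq (by simp)
  refine ⟨of fun a i => b i a, ?_, c, fun i hi => ⟨?_, fun a => ?_⟩⟩
  · rw [mem_unitaryGroup_iff']
    ext i j
    have := orthonormal_iff_ite.mp b.orthonormal i j
    rw [PiLp.inner_apply] at this
    simp only [Matrix.mul_apply, star_apply, of_apply, Matrix.one_apply]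
    rw [← this]
    simp [mul_comm]
  · simpa [c] using hw i hi
  · simp [hb i hi, w]

/-- The diagonal unitary with entry `i` at `m` and `1` elsewhere. The powers `-1, 0, 1, 2` of `i`
are distinct, so conjugation by it tells all weights of `U ⊗ U ⊗ U*` at `m` apart. -/
theorem diagonal_I_mem_unitaryGroup (m : Fin d) :
    diagonal (fun j => if j = m then Complex.I else 1) ∈ unitaryGroup (Fin d) ℂ := by
  rw [mem_unitaryGroup_iff, star_eq_conjTranspose, diagonal_conjTranspose,
    diagonal_mul_diagonal, ← diagonal_one]
  congr 1
  ext j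
  by_cases h : j = m <;> simp [h]

/-- Schur's lemma for the defining representation of the unitary group. -/
theorem eq_smul_one_of_commute_unitary {N : Op (Fin d)}
    (hN : ∀ U ∈ unitaryGroup (Fin d) ℂ, U * N = N * U) : ∃ c : ℂ, N = c • 1 := by
  have hoff : ∀ p q, p ≠ q → N p q = 0 := by
    intro p q hpq
    have h := congrFun₂ (hN _ (diagonal_I_mem_unitaryGroup p)) p q
    simp only [diagonal_mul, mul_diagonal, if_true, if_neg hpq.symm] at h
    have h1 : (Complex.I - 1) * N p q = 0 := by linear_combination h
    have h2 : Complex.I - 1 ≠ 0 := fun h => by simpa using congrArg Complex.re h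
    exact (mul_eq_zero.mp h1).resolve_left h2
  have hdiag : ∀ p q, N p p = N q q := by
    intro p q
    -- a unitary whose column `p` has no zero entry
    obtain ⟨U, hU, c, hc⟩ := exists_unitary_columns (fun _ _ => (1 : ℂ)) {p}
      (fun i _ h => one_ne_zero (congrFun h p)) (by simp +contextual)
    obtain ⟨hc0, hc⟩ := hc p rfl
    have h := congrFun₂ (hN U hU) q p
    rw [Matrix.mul_apply, Matrix.mul_apply, Finset.sum_eq_single p, Finset.sum_eq_single q, hc] at h
    · rw [mul_one, mul_comm] at h
      exact mul_right_cancel₀ hc0 h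
    · intro b _ hb; rw [hoff q b hb.symm, zero_mul]
    · simp
    · intro b _ hb; rw [hoff b p hb, mul_zero]
    · simp
  rcases Nat.eq_zero_or_pos d with rfl | hd
  · exact ⟨0, Subsingleton.elim _ _⟩
  · refine ⟨N ⟨0, hd⟩ ⟨0, hd⟩, ?_⟩
    ext p q
    by_cases h : p = q
    · subst h; simp [hdiag p ⟨0, hd⟩]
    · simp [hoff p q h, h]

end Representation

/-! ### The commutant of `U ⊗ U ⊗ U*` -/

section Commutant

variable {d : ℕ}

/-- An operator commuting with all `U ⊗ U ⊗ U*` preserves weights, here evaluated on the diagonal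
unitaries with a single entry `i`. -/
theorem weight_eq_of_apply_ne_zero {X : Op (Pair d × Fin d)}
    (hX : ∀ U ∈ unitaryGroup (Fin d) ℂ, mixedTensor U * X = X * mixedTensor U)
    {p q : Pair d × Fin d} (h : X p q ≠ 0) (m : Fin d) :
    (if p.1.1 = m then Complex.I else 1) * (if p.1.2 = m then Complex.I else 1)
        * (if p.2 = m then -Complex.I else 1)
      = (if q.1.1 = m then Complex.I else 1) * (if q.1.2 = m then Complex.I else 1)
        * (if q.2 = m then -Complex.I else 1) := by
  have e : mixedTensor (diagonal (fun j => if j = m then Complex.I else 1))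
      = diagonal (fun p : Pair d × Fin d => (if p.1.1 = m then Complex.I else 1)
        * (if p.1.2 = m then Complex.I else 1) * (if p.2 = m then -Complex.I else 1)) := by
    have hs : (diagonal (fun j : Fin d => if j = m then Complex.I else 1)).map star
        = diagonal (fun j => if j = m then -Complex.I else 1) := by
      rw [diagonal_map (star_zero ℂ)]
      congr 1
      ext j
      by_cases h : j = m <;> simp [h]
    rw [mixedTensor, hs, diagonal_kronecker_diagonal, diagonal_kronecker_diagonal]
  have := congrFun₂ (hX _ (diagonal_I_mem_unitaryGroup m)) p q
  rw [e, diagonal_mul, mul_diagonal, mul_comm (X p q)] at this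
  exact mul_right_cancel₀ h this

/-- The weight space of `eᵢ ⊗ eᵢ ⊗ eₖ*` is one-dimensional. -/
theorem eq_of_apply_ne_zero_of_sym {X : Op (Pair d × Fin d)}
    (hX : ∀ U ∈ unitaryGroup (Fin d) ℂ, mixedTensor U * X = X * mixedTensor U)
    {p : Pair d × Fin d} {i k : Fin d} (hik : i ≠ k) (h : X p ((i, i), k) ≠ 0) :
    p = ((i, i), k) := by
  obtain ⟨⟨a, b⟩, c⟩ := p
  have h1 := weight_eq_of_apply_ne_zero hX h i
  have h2 := weight_eq_of_apply_ne_zero hX h k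
  have hI := Complex.I_mul_I
  have hki := hik.symm
  simp only [hik, hki, if_true, if_false] at h1 h2
  have key : a = i ∧ b = i ∧ c ≠ i := by
    by_cases ha : a = i <;> by_cases hb : b = i <;> by_cases hc : c = i <;>
      simp [ha, hb, hc, Complex.ext_iff] at h1 ⊢ <;> norm_num at h1
  obtain ⟨rfl, rfl, hc⟩ := key
  by_cases hck : c = k
  · rw [hck]
  · simp [hik, hck, Complex.ext_iff] at h2

/-- The weight space of `eᵢ ⊗ eⱼ ⊗ eₖ*` is spanned by this vector and `eⱼ ⊗ eᵢ ⊗ eₖ*`. -/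
theorem eq_or_eq_of_apply_ne_zero_of_distinct {X : Op (Pair d × Fin d)}
    (hX : ∀ U ∈ unitaryGroup (Fin d) ℂ, mixedTensor U * X = X * mixedTensor U)
    {p : Pair d × Fin d} {i j k : Fin d} (hij : i ≠ j) (hik : i ≠ k) (hjk : j ≠ k)
    (h : X p ((i, j), k) ≠ 0) : p = ((i, j), k) ∨ p = ((j, i), k) := by
  obtain ⟨⟨a, b⟩, c⟩ := p
  have h1 := weight_eq_of_apply_ne_zero hX h i
  have h2 := weight_eq_of_apply_ne_zero hX h j
  have h3 := weight_eq_of_apply_ne_zero hX h k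
  simp only [hij, hik, hjk, hij.symm, hik.symm, hjk.symm, if_true, if_false] at h1 h2 h3
  have key : ∀ m : Fin d, (if a = m then Complex.I else 1) * (if b = m then Complex.I else 1)
        * (if c = m then -Complex.I else 1) = Complex.I → a = m ∨ b = m := by
    intro m hm
    by_cases ha : a = m <;> by_cases hb : b = m <;> by_cases hc : c = m <;>
      simp [ha, hb, hc, Complex.ext_iff] at hm ⊢
    norm_num at hm
  have hc : c = k := by
    by_cases ha : a = k <;> by_cases hb : b = k <;> by_cases hc : c = k <;>
      simp [ha, hb, hc, Complex.ext_iff] at h3 ⊢ <;> norm_num at h3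
  have hi := key i (by simpa using h1)
  have hj := key j (by simpa using h2)
  subst hc
  rcases hi with rfl | rfl <;> rcases hj with rfl | rfl
  · exact absurd rfl hij
  · exact Or.inl rfl
  · exact Or.inr rfl
  · exact absurd rfl hij

/-- A tensor, symmetric in its first two arguments, that vanishes on `u ⊗ u ⊗ v*` for all `u ⊥ v`
is the symmetrization of some `x ⊗ δ`. -/
theorem exists_eq_of_sym {t : Fin d → Fin d → Fin d → ℂ}
    (hs : ∀ a b c, t a b c = t b a c)
    (h : ∀ u v : Fin d → ℂ, u ≠ 0 → v ≠ 0 → ∑ a, star (u a) * v a = 0 →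
      ∑ a, ∑ b, ∑ c, t a b c * (u a * u b * star (v c)) = 0) :
    ∃ x : Fin d → ℂ, ∀ a b c,
      t a b c = (if b = c then x a else 0) + (if a = c then x b else 0) := by
  have h1 : ∀ i k, i ≠ k → t i i k = 0 := by
    intro i k hik
    have := h (Pi.single i 1) (Pi.single k 1) (by simp) (by simp)
      (by simp [Pi.single_apply, hik.symm])
    simpa [Pi.single_apply, apply_ite (starRingEnd ℂ)] using this
  have h2 : ∀ i j k, i ≠ j → i ≠ k → j ≠ k → t i j k = 0 := by
    intro i j k hij hik hjk
    -- `u = eᵢ + eⱼ`, `v = eₖ`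
    have := h (fun a => (if a = i then 1 else 0) + (if a = j then 1 else 0)) (Pi.single k 1)
      (fun h => by simpa [hij] using congrFun h i) (by simp)
      (by simp [Pi.single_apply, hik.symm, hjk.symm])
    simp [Pi.single_apply, apply_ite (starRingEnd ℂ), mul_add, Finset.sum_add_distrib]
      at this
    rw [h1 i k hik, h1 j k hjk, hs j i k] at this
    linear_combination (1 / 2) * this
  have h3 : ∀ i j, i ≠ j → t j j j = 2 * t j i i := by
    intro i j hij
    -- `u = eᵢ + z eⱼ`, `v = eᵢ - z eⱼ` with `z = 1, i`, to separate the two terms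
    have hz : ∀ z : ℂ, z * star z = 1 →
        t i i i - 2 * t i j j + z * (2 * t i j i - t j j j) = 0 := by
      intro z hz
      have hz' : z * (starRingEnd ℂ) z = 1 := hz
      have := h (fun a => (if a = i then 1 else 0) + (if a = j then z else 0))
        (fun a => (if a = i then 1 else 0) + (if a = j then -z else 0))
        (fun h => by simpa [hij] using congrFun h i) (fun h => by simpa [hij] using congrFun h i)
        (by
          simp [apply_ite (starRingEnd ℂ), add_mul, mul_add, Finset.sum_add_distrib, hij, hij.symm]
          linear_combination -hz')
      simp [apply_ite (starRingEnd ℂ), add_mul, mul_add, Finset.sum_add_distrib]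
        at this
      rw [h1 i j hij, h1 j i hij.symm, hs j i i, hs j i j] at this
      linear_combination this + (2 * t i j j + z * t j j j) * hz'
    have e1 := hz 1 (by simp)
    have e2 := hz Complex.I (by simp)
    have e3 : (1 - Complex.I) * (2 * t i j i - t j j j) = 0 := by linear_combination e1 - e2
    have e4 : 1 - Complex.I ≠ 0 := fun h => by simpa using congrArg Complex.re h
    have e5 := (mul_eq_zero.mp e3).resolve_left e4
    rw [hs j i i]
    linear_combination -e5
  refine ⟨fun a => t a a a / 2, fun a b c => ?_⟩
  by_cases hab : a = b
  · subst hab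
    by_cases hac : a = c
    · subst hac; simp
    · simp [hac, h1 a c hac]
  · by_cases hbc : b = c
    · subst hbc
      simp [hab]
      linear_combination -(1 / 2) * h3 b a (Ne.symm hab)
    · by_cases hac : a = c
      · subst hac
        simp [hbc]
        rw [hs]
        linear_combination -(1 / 2) * h3 a b hab
      · simp [hac, hbc, h2 a b c hab hac hbc]

/-- A tensor, antisymmetric in its first two arguments, that vanishes on `u ⊗ v ⊗ w*` for all
pairwise orthogonal `u`, `v`, `w` is the antisymmetrization of some `x ⊗ δ`. For `d = 2` there are
no such triples, and antisymmetry alone suffices. -/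
theorem exists_eq_of_antisym (hd : 2 ≤ d) {t : Fin d → Fin d → Fin d → ℂ}
    (hs : ∀ a b c, t a b c = -t b a c)
    (h : 3 ≤ d → ∀ u v w : Fin d → ℂ, u ≠ 0 → v ≠ 0 → w ≠ 0 → ∑ a, star (u a) * v a = 0 →
      ∑ a, star (u a) * w a = 0 → ∑ a, star (v a) * w a = 0 →
      ∑ a, ∑ b, ∑ c, t a b c * (u a * v b * star (w c)) = 0) :
    ∃ x : Fin d → ℂ, ∀ a b c,
      t a b c = (if b = c then x a else 0) - (if a = c then x b else 0) := by
  have hcard : ∀ i j k : Fin d, i ≠ j → i ≠ k → j ≠ k → 3 ≤ d := fun i j k _ _ _ => by omega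
  have h0 : ∀ a c, t a a c = 0 := fun a c => by linear_combination (1 / 2) * hs a a c
  have h1 : ∀ i j k, i ≠ j → i ≠ k → j ≠ k → t i j k = 0 := by
    intro i j k hij hik hjk
    have := h (hcard i j k hij hik hjk) (Pi.single i 1) (Pi.single j 1) (Pi.single k 1) (by simp)
      (by simp) (by simp) (by simp [Pi.single_apply, hij.symm])
      (by simp [Pi.single_apply, hik.symm]) (by simp [Pi.single_apply, hjk.symm])
    simpa [Pi.single_apply, apply_ite (starRingEnd ℂ)] using this
  have h2 : ∀ i j k, i ≠ j → i ≠ k → t i j j = t i k k := by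
    intro i j k hij hik
    by_cases hjk : j = k
    · rw [hjk]
    -- `u = eᵢ`, `v = eⱼ + eₖ`, `w = eⱼ - eₖ`
    have := h (hcard i j k hij hik hjk) (Pi.single i 1)
      (fun a => (if a = j then 1 else 0) + (if a = k then 1 else 0))
      (fun a => (if a = j then 1 else 0) + (if a = k then -1 else 0)) (by simp)
      (fun h => by simpa [hjk] using congrFun h j) (fun h => by simpa [hjk] using congrFun h j)
      (by simp [Pi.single_apply, hij, hik])
      (by simp [Pi.single_apply, hij, hik])
      (by simp [apply_ite (starRingEnd ℂ), mul_add, Finset.sum_add_distrib, hjk,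
            Ne.symm hjk])
    simp [Pi.single_apply, apply_ite (starRingEnd ℂ), mul_add, Finset.sum_add_distrib]
      at this
    rw [h1 i j k hij hik hjk, h1 i k j hik hij (Ne.symm hjk)] at this
    linear_combination this
  have : Nontrivial (Fin d) := Fin.nontrivial_iff_two_le.mpr hd
  choose σ hσ using fun i : Fin d => exists_ne i
  refine ⟨fun a => t a (σ a) (σ a), fun a b c => ?_⟩
  by_cases hab : a = b
  · subst hab; simp [h0]
  · by_cases hbc : b = c
    · subst hbc
      simp [hab, h2 a b (σ a) hab (hσ a).symm]
    · by_cases hac : a = c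
      · subst hac
        simp [hbc]
        rw [hs, h2 b a (σ b) (Ne.symm hab) (hσ b).symm]
      · simp [hac, hbc, h1 a b c hab hac hbc]

/-- An operator commuting with all `U ⊗ U ⊗ U*` and vanishing on a highest weight vector vanishes
on its whole orbit. -/
theorem sum_apply_mul_eq_zero {Z : Op (Pair d × Fin d)}
    (hZ : ∀ U ∈ unitaryGroup (Fin d) ℂ, mixedTensor U * Z = Z * mixedTensor U) {i j k : Fin d}
    (h0 : ∀ r, Z r ((i, j), k) = 0) {U : Op (Fin d)} (hU : U ∈ unitaryGroup (Fin d) ℂ)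
    (r : Pair d × Fin d) :
    ∑ a, ∑ b, ∑ c, Z r ((a, b), c) * (U a i * U b j * star (U c k)) = 0 := by
  have h := congrFun₂ (hZ U hU) r ((i, j), k)
  simp only [Matrix.mul_apply, h0, mul_zero, Finset.sum_const_zero] at h
  simpa only [Fintype.sum_prod_type, mixedTensor_apply] using h.symm

theorem commute_conjTranspose {Z : Op (Pair d × Fin d)}
    (hZ : ∀ U ∈ unitaryGroup (Fin d) ℂ, mixedTensor U * Z = Z * mixedTensor U)
    (U : Op (Fin d)) (hU : U ∈ unitaryGroup (Fin d) ℂ) :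
    mixedTensor U * Zᴴ = Zᴴ * mixedTensor U := by
  have h := congrArg conjTranspose (hZ (star U) (Unitary.star_mem hU))
  rw [conjTranspose_mul, conjTranspose_mul, mixedTensor_conjTranspose, star_eq_conjTranspose,
    conjTranspose_conjTranspose] at h
  exact h.symm

/-- An operator that commutes with all `U ⊗ U ⊗ U*` and annihilates a highest weight vector of
`P₊ (H ⊗ H) ⊗ H*` factors through the copy of `H`. -/
theorem exists_eq_mul_embed_sym {Z : Op (Pair d × Fin d)}
    (hZ : ∀ U ∈ unitaryGroup (Fin d) ℂ, mixedTensor U * Z = Z * mixedTensor U)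
    (hP : Z * mixedProj d 0 = Z) {i k : Fin d} (hik : i ≠ k)
    (h0 : Z ((i, i), k) ((i, i), k) = 0) :
    ∃ Y : Matrix (Pair d × Fin d) (Fin d) ℂ, Z = Y * (embed d 0)ᴴ := by
  have hcol : ∀ r, Z r ((i, i), k) = 0 := by
    intro r
    by_contra h
    rw [eq_of_apply_ne_zero_of_sym hZ hik h] at h
    exact h h0
  have hrow : ∀ r, ∃ x : Fin d → ℂ, ∀ a b c, Z r ((a, b), c)
      = (if b = c then x a else 0) + (if a = c then x b else 0) := by
    intro r
    refine exists_eq_of_sym (fun a b c => ?_) (fun u v hu hv huv => ?_)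
    · have h := congrFun₂ hP r ((a, b), c)
      rw [mul_mixedProj_apply] at h
      simp [swapSign] at h
      linear_combination -2 * h
    · obtain ⟨U, hU, c, hc⟩ := exists_unitary_columns (fun j => if j = i then u else v) {i, k}
        (by simp [hu, hv, hik.symm]) (by
          have hvu : ∑ a, star (v a) * u a = 0 := by
            simpa [mul_comm] using congrArg star huv
          have hki := hik.symm
          clear hcol h0
          rintro _ (rfl | rfl) _ (rfl | rfl) h <;> simp_all)
      have hci := hc i (by simp)
      have hck := hc k (by simp)
      simp only [if_true, hik.symm, if_false] at hci hck
      have h := sum_apply_mul_eq_zero hZ hcol hU r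
      have e : ∑ a, ∑ b, ∑ e, Z r ((a, b), e) * (U a i * U b i * star (U e k))
          = (c i * c i * star (c k))
            * ∑ a, ∑ b, ∑ e, Z r ((a, b), e) * (u a * u b * star (v e)) := by
        simp only [Finset.mul_sum, hci.2, hck.2, star_mul']
        refine Finset.sum_congr rfl fun a _ => Finset.sum_congr rfl fun b _ =>
          Finset.sum_congr rfl fun e _ => ?_
        ring
      rw [e] at h
      exact (mul_eq_zero.mp h).resolve_left
        (mul_ne_zero (mul_ne_zero hci.1 hci.1) (star_ne_zero.mpr hck.1))
  choose x hx using hrow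
  refine ⟨of x, ?_⟩
  ext r ⟨⟨a, b⟩, c⟩
  rw [hx, embed_conjTranspose_eq_transpose, Matrix.mul_apply]
  simp [embed_apply, swapSign, mul_add, Finset.sum_add_distrib, ite_and]

/-- An operator that commutes with all `U ⊗ U ⊗ U*` and, for `d ≥ 3`, annihilates a highest weight
vector of `P₋ (H ⊗ H) ⊗ H*` factors through the copy of `H`. -/
theorem exists_eq_mul_embed_antisym (hd : 2 ≤ d) {Z : Op (Pair d × Fin d)}
    (hZ : ∀ U ∈ unitaryGroup (Fin d) ℂ, mixedTensor U * Z = Z * mixedTensor U)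
    (hP : Z * mixedProj d 1 = Z) (hP' : mixedProj d 1 * Z = Z)
    (h0 : 3 ≤ d → ∃ i j k : Fin d, i ≠ j ∧ i ≠ k ∧ j ≠ k ∧ Z ((i, j), k) ((i, j), k) = 0) :
    ∃ Y : Matrix (Pair d × Fin d) (Fin d) ℂ, Z = Y * (embed d 1)ᴴ := by
  have hrow : ∀ r, ∃ x : Fin d → ℂ, ∀ a b c, Z r ((a, b), c)
      = (if b = c then x a else 0) - (if a = c then x b else 0) := by
    intro r
    refine exists_eq_of_antisym hd (fun a b c => ?_) (fun h3 u v w hu hv hw huv huw hvw => ?_)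
    · have h := congrFun₂ hP r ((a, b), c)
      rw [mul_mixedProj_apply] at h
      simp [swapSign] at h
      linear_combination -2 * h
    · obtain ⟨i, j, k, hij, hik, hjk, h0⟩ := h0 h3
      have hcol : ∀ r, Z r ((i, j), k) = 0 := by
        intro r
        by_contra h
        rcases eq_or_eq_of_apply_ne_zero_of_distinct hZ hij hik hjk h with rfl | rfl
        · exact h h0
        · have h' := congrFun₂ hP' ((j, i), k) ((i, j), k)
          rw [mixedProj_mul_apply, h0] at h'
          apply h
          simp [swapSign] at h'
          linear_combination -2 * h'
      obtain ⟨U, hU, c, hc⟩ := exists_unitary_columns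
        (fun l => if l = i then u else if l = j then v else w) {i, j, k}
        (by simp [hu, hv, hw, hik.symm, hij.symm, hjk.symm]) (by
          have hvu : ∑ a, star (v a) * u a = 0 := by
            simpa [mul_comm] using congrArg star huv
          have hwu : ∑ a, star (w a) * u a = 0 := by
            simpa [mul_comm] using congrArg star huw
          have hwv : ∑ a, star (w a) * v a = 0 := by
            simpa [mul_comm] using congrArg star hvw
          have hji := hij.symm
          have hki := hik.symm
          have hkj := hjk.symm
          clear hcol h0
          rintro _ (rfl | rfl | rfl) _ (rfl | rfl | rfl) h <;> simp_all)
      have hci := hc i (by simp)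
      have hcj := hc j (by simp)
      have hck := hc k (by simp)
      simp only [if_true, hik.symm, hij.symm, hjk.symm, if_false] at hci hcj hck
      have h := sum_apply_mul_eq_zero hZ hcol hU r
      have e : ∑ a, ∑ b, ∑ e, Z r ((a, b), e) * (U a i * U b j * star (U e k))
          = (c i * c j * star (c k))
            * ∑ a, ∑ b, ∑ e, Z r ((a, b), e) * (u a * v b * star (w e)) := by
        simp only [Finset.mul_sum, hci.2, hcj.2, hck.2, star_mul']
        refine Finset.sum_congr rfl fun a _ => Finset.sum_congr rfl fun b _ =>
          Finset.sum_congr rfl fun e _ => ?_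
        ring
      rw [e] at h
      exact (mul_eq_zero.mp h).resolve_left
        (mul_ne_zero (mul_ne_zero hci.1 hcj.1) (star_ne_zero.mpr hck.1))
  choose x hx using hrow
  refine ⟨of x, ?_⟩
  ext r ⟨⟨a, b⟩, c⟩
  rw [hx, embed_conjTranspose_eq_transpose, Matrix.mul_apply]
  simp [embed_apply, swapSign, mul_add, Finset.sum_add_distrib, ite_and, sub_eq_add_neg, neg_ite]

/-- Subtracting from an element of the commutant its eigenvalue at the highest weight vector leaves
an operator which, like its adjoint, factors through the copy of `H`. -/
theorem exists_eq_mul_embed_sub (hd : 2 ≤ d) (i : Fin 2) {X : Op (Pair d × Fin d)}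
    (hX : ∀ U ∈ unitaryGroup (Fin d) ℂ, mixedTensor U * X = X * mixedTensor U)
    (hP : X * mixedProj d i = X) (hP' : mixedProj d i * X = X) :
    ∃ l : ℂ, ∃ Y Y' : Matrix (Pair d × Fin d) (Fin d) ℂ,
      X - l • mixedProj d i = Y * (embed d i)ᴴ ∧ (X - l • mixedProj d i)ᴴ = Y' * (embed d i)ᴴ := by
  have hZ : ∀ l : ℂ, ∀ U ∈ unitaryGroup (Fin d) ℂ,
      mixedTensor U * (X - l • mixedProj d i) = (X - l • mixedProj d i) * mixedTensor U := by
    intro l U hU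
    simp only [Matrix.mul_sub, Matrix.sub_mul, hX U hU, Matrix.mul_smul, Matrix.smul_mul,
      mixedProj_mul_mixedTensor]
  have hZP : ∀ l : ℂ, (X - l • mixedProj d i) * mixedProj d i = X - l • mixedProj d i := by
    intro l
    rw [Matrix.sub_mul, hP, Matrix.smul_mul, mixedProj_mul_self]
  have hPZ : ∀ l : ℂ, mixedProj d i * (X - l • mixedProj d i) = X - l • mixedProj d i := by
    intro l
    rw [Matrix.mul_sub, hP', Matrix.mul_smul, mixedProj_mul_self]
  have hZP' : ∀ l : ℂ, (X - l • mixedProj d i)ᴴ * mixedProj d i = (X - l • mixedProj d i)ᴴ := by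
    intro l
    have h := congrArg conjTranspose (hPZ l)
    rwa [conjTranspose_mul, mixedProj_conjTranspose] at h
  have hPZ' : ∀ l : ℂ, mixedProj d i * (X - l • mixedProj d i)ᴴ = (X - l • mixedProj d i)ᴴ := by
    intro l
    have h := congrArg conjTranspose (hZP l)
    rwa [conjTranspose_mul, mixedProj_conjTranspose] at h
  have h01 : (⟨0, by omega⟩ : Fin d) ≠ ⟨1, by omega⟩ := by simp
  -- `l` is chosen so that the diagonal entry of `X - l` at the highest weight vanishes
  fin_cases i
  · let w : Pair d × Fin d := ((⟨0, by omega⟩, ⟨0, by omega⟩), ⟨1, by omega⟩)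
    have hw : (X - X w w • mixedProj d 0) w w = 0 := by
      have : mixedProj d 0 w w = 1 := by
        simp [w, mixedProj_apply, proj_apply, swapSign]
        norm_num
      simp [this]
    obtain ⟨Y, hY⟩ := exists_eq_mul_embed_sym (hZ _) (hZP _) h01 hw
    obtain ⟨Y', hY'⟩ := exists_eq_mul_embed_sym (commute_conjTranspose (hZ _)) (hZP' _) h01
      (by rw [conjTranspose_apply]; exact (congrArg star hw).trans (star_zero _))
    exact ⟨_, Y, Y', hY, hY'⟩
  · by_cases h3 : 3 ≤ d
    · let w : Pair d × Fin d := ((⟨0, by omega⟩, ⟨1, by omega⟩), ⟨2, by omega⟩)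
      have hw : (X - (2 * X w w) • mixedProj d 1) w w = 0 := by
        have : mixedProj d 1 w w = 1 / 2 := by
          simp [w, mixedProj_apply, proj_apply, swapSign]
        simp only [Matrix.sub_apply, Matrix.smul_apply, this, smul_eq_mul]
        ring
      obtain ⟨Y, hY⟩ := exists_eq_mul_embed_antisym hd (hZ _) (hZP _) (hPZ _)
        (fun _ => ⟨_, _, _, by simp, by simp, by simp, hw⟩)
      obtain ⟨Y', hY'⟩ := exists_eq_mul_embed_antisym hd (commute_conjTranspose (hZ _)) (hZP' _)
        (hPZ' _) (fun _ => ⟨⟨0, by omega⟩, ⟨1, by omega⟩, ⟨2, by omega⟩, by simp, by simp, by simp,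
          by rw [conjTranspose_apply]; exact (congrArg star hw).trans (star_zero _)⟩)
      exact ⟨_, Y, Y', hY, hY'⟩
    · obtain ⟨Y, hY⟩ := exists_eq_mul_embed_antisym hd (hZ 0) (hZP _) (hPZ _)
        (fun h => absurd h h3)
      obtain ⟨Y', hY'⟩ := exists_eq_mul_embed_antisym hd (commute_conjTranspose (hZ 0)) (hZP' _)
        (hPZ' _) (fun h => absurd h h3)
      exact ⟨_, Y, Y', hY, hY'⟩

theorem embed_conjTranspose_mul_mixedTensor (i : Fin 2) {U : Op (Fin d)}
    (hU : U ∈ unitaryGroup (Fin d) ℂ) :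
    (embed d i)ᴴ * mixedTensor U = U * (embed d i)ᴴ := by
  have h := congrArg conjTranspose (mixedTensor_mul_embed i (Unitary.star_mem hU))
  rwa [conjTranspose_mul, conjTranspose_mul, mixedTensor_conjTranspose, star_eq_conjTranspose,
    conjTranspose_conjTranspose] at h

theorem embed_norm_ne_zero (hd : 2 ≤ d) (i : Fin 2) : (2 * (d + swapSign i) : ℂ) ≠ 0 := by
  have h : (2 : ℝ) ≤ d := by exact_mod_cast hd
  have : (2 * (d + swapSign i) : ℝ) ≠ 0 := by
    fin_cases i <;> simp [swapSign] <;> linarith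
  exact_mod_cast this

/-- The commutant of `U ⊗ U ⊗ U*` on `P± (H ⊗ H) ⊗ H*` is spanned by the identity and the
projector on the unique subrepresentation equivalent to `H`. -/
theorem exists_eq_of_commute_mixedTensor (hd : 2 ≤ d) (i : Fin 2) {X : Op (Pair d × Fin d)}
    (hX : ∀ U ∈ unitaryGroup (Fin d) ℂ, mixedTensor U * X = X * mixedTensor U)
    (hP : X * mixedProj d i = X) (hP' : mixedProj d i * X = X) :
    ∃ l m : ℂ, X = l • mixedProj d i + m • (embed d i * (embed d i)ᴴ) := by
  obtain ⟨l, Y, Y', hY, hY'⟩ := exists_eq_mul_embed_sub hd i hX hP hP'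
  have hk := embed_norm_ne_zero hd i
  set κ : ℂ := 2 * (d + swapSign i)
  have hE := embed_conjTranspose_mul_embed (d := d) i
  have hY2 : X - l • mixedProj d i = embed d i * Y'ᴴ := by
    rw [← conjTranspose_conjTranspose (X - _), hY', conjTranspose_mul, conjTranspose_conjTranspose]
  -- `X - l` factors through `H` on both sides, so it is the image of an operator `N` on `H`
  let N : Op (Fin d) := κ⁻¹ • (Y'ᴴ * embed d i)
  have hN : X - l • mixedProj d i = embed d i * N * (embed d i)ᴴ := by
    have h1 : κ • Y = embed d i * (Y'ᴴ * embed d i) := by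
      rw [← Matrix.mul_assoc, ← hY2, hY, Matrix.mul_assoc, hE, Matrix.mul_smul, Matrix.mul_one]
    have h2 : Y = embed d i * N := by
      rw [Matrix.mul_smul, ← h1, smul_smul, inv_mul_cancel₀ hk, one_smul]
    rw [hY, ← h2]
  have hcomm : ∀ U ∈ unitaryGroup (Fin d) ℂ, U * N = N * U := by
    intro U hU
    have hZ : mixedTensor U * (X - l • mixedProj d i)
        = (X - l • mixedProj d i) * mixedTensor U := by
      simp only [Matrix.mul_sub, Matrix.sub_mul, hX U hU, Matrix.mul_smul, Matrix.smul_mul,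
        mixedProj_mul_mixedTensor]
    rw [hN, ← Matrix.mul_assoc, ← Matrix.mul_assoc, mixedTensor_mul_embed i hU,
      Matrix.mul_assoc _ _ (mixedTensor U), embed_conjTranspose_mul_mixedTensor i hU] at hZ
    have h := congrArg (fun T => (embed d i)ᴴ * T * embed d i) hZ
    simp only [Matrix.mul_assoc, hE] at h
    simp only [← Matrix.mul_assoc, hE] at h
    simp only [Matrix.mul_smul, Matrix.smul_mul, Matrix.mul_one, Matrix.one_mul, smul_smul] at h
    exact smul_right_injective _ (mul_ne_zero hk hk) h
  obtain ⟨m, hm⟩ := eq_smul_one_of_commute_unitary hcomm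
  refine ⟨l, m, ?_⟩
  rw [← sub_eq_iff_eq_add', hN, hm, Matrix.mul_smul, Matrix.smul_mul, Matrix.mul_one]

end Commutant

/-! ### Averages over the unitary group -/

open MeasureTheory

section Haar

variable {d : ℕ}

instance : IsProbabilityMeasure (unitaryHaar (Fin d)) :=
  ⟨by
    have h := Measure.haarMeasure_self
      (K₀ := (⊤ : TopologicalSpace.PositiveCompacts (unitaryGroup (Fin d) ℂ)))
    rwa [TopologicalSpace.PositiveCompacts.coe_top] at h⟩

theorem integral_unitaryHaar_mul_left (V : unitaryGroup (Fin d) ℂ)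
    (f : unitaryGroup (Fin d) ℂ → ℂ) :
    ∫ U, f (V * U) ∂(unitaryHaar (Fin d)) = ∫ U, f U ∂(unitaryHaar (Fin d)) := by
  have : (unitaryHaar (Fin d)).IsMulLeftInvariant := by unfold unitaryHaar; infer_instance
  exact integral_mul_left_eq_self f V

theorem integrable_unitaryHaar {E : Type} [NormedAddCommGroup E] [SecondCountableTopology E]
    {f : unitaryGroup (Fin d) ℂ → E} (hf : Continuous f) : Integrable f (unitaryHaar (Fin d)) := by
  have := hf.continuousOn.integrableOn_compact (μ := unitaryHaar (Fin d)) isCompact_univ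
  rwa [integrableOn_univ] at this

theorem continuous_mixedTensor_apply (p q : Pair d × Fin d) :
    Continuous fun U : unitaryGroup (Fin d) ℂ => mixedTensor (U : Op (Fin d)) p q := by
  have h : ∀ i j, Continuous fun U : unitaryGroup (Fin d) ℂ => (U : Op (Fin d)) i j :=
    fun i j => (continuous_apply_apply i j).comp continuous_subtype_val
  simp only [mixedTensor_apply]
  exact ((h _ _).mul (h _ _)).mul (h _ _).star

/-- The average over the unitary group of the conjugates of `Y` by `U ⊗ U ⊗ U*`. -/
noncomputable def twirl (Y : Op (Pair d × Fin d)) : Op (Pair d × Fin d) :=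
  of fun p q => ∫ U : unitaryGroup (Fin d) ℂ,
    (mixedTensor (U : Op (Fin d)) * Y * (mixedTensor (U : Op (Fin d)))ᴴ) p q ∂(unitaryHaar (Fin d))

theorem continuous_conj_apply (Y : Op (Pair d × Fin d)) (p q : Pair d × Fin d) :
    Continuous fun U : unitaryGroup (Fin d) ℂ =>
      (mixedTensor (U : Op (Fin d)) * Y * (mixedTensor (U : Op (Fin d)))ᴴ) p q := by
  simp only [Matrix.mul_apply, conjTranspose_apply]
  exact continuous_finsetSum _ fun r _ => (continuous_finsetSum _ fun s _ =>
    (continuous_mixedTensor_apply p s).mul continuous_const).mul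
      (continuous_mixedTensor_apply q r).star

/-- Averaging commutes with multiplication by constant operators. -/
theorem mul_twirl_mul_apply (A Y B : Op (Pair d × Fin d)) (p q : Pair d × Fin d) :
    (A * twirl Y * B) p q = ∫ U : unitaryGroup (Fin d) ℂ,
      (A * (mixedTensor (U : Op (Fin d)) * Y * (mixedTensor (U : Op (Fin d)))ᴴ) * B) p q
        ∂(unitaryHaar (Fin d)) := by
  have hi := fun p q => integrable_unitaryHaar (continuous_conj_apply Y p q)
  simp only [Matrix.mul_apply (M := A * _), Matrix.mul_apply (M := A)]
  rw [integral_finsetSum]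
  · refine Finset.sum_congr rfl fun r _ => ?_
    rw [integral_mul_const, integral_finsetSum]
    · congr 1
      refine Finset.sum_congr rfl fun s _ => ?_
      rw [integral_const_mul]
      rfl
    · exact fun s _ => (hi _ _).const_mul _
  · exact fun r _ => (integrable_finsetSum _ fun s _ => (hi _ _).const_mul _).mul_const _

/-- Left invariance of the Haar measure puts every twirl in the commutant. -/
theorem mixedTensor_mul_twirl (Y : Op (Pair d × Fin d)) (V : Op (Fin d))
    (hV : V ∈ unitaryGroup (Fin d) ℂ) :
    mixedTensor V * twirl Y = twirl Y * mixedTensor V := by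
  have h : mixedTensor V * twirl Y * (mixedTensor V)ᴴ = twirl Y := by
    ext p q
    rw [mul_twirl_mul_apply]
    have := integral_unitaryHaar_mul_left ⟨V, hV⟩ (fun U : unitaryGroup (Fin d) ℂ =>
      (mixedTensor (U : Op (Fin d)) * Y * (mixedTensor (U : Op (Fin d)))ᴴ) p q)
    simp only [Submonoid.coe_mul, mixedTensor_mul, conjTranspose_mul, Matrix.mul_assoc] at this
    simpa only [Matrix.mul_assoc, twirl, of_apply] using this
  conv_rhs => rw [← h]
  rw [Matrix.mul_assoc _ _ (mixedTensor V), conjTranspose_mul_mixedTensor hV, Matrix.mul_one]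

/-- An operator commuting with all `U ⊗ U ⊗ U*` can be moved out of the twirl. -/
theorem twirl_mul_of_commute {B : Op (Pair d × Fin d)}
    (hB : ∀ U ∈ unitaryGroup (Fin d) ℂ, mixedTensor U * B = B * mixedTensor U)
    (Y : Op (Pair d × Fin d)) : twirl (Y * B) = twirl Y * B := by
  have hB' := commute_conjTranspose hB
  ext p q
  have := mul_twirl_mul_apply 1 Y B p q
  rw [Matrix.one_mul] at this
  rw [this]
  refine integral_congr_ae (.of_forall fun U => ?_)
  have h : (mixedTensor (U : Op (Fin d)))ᴴ * B = B * (mixedTensor (U : Op (Fin d)))ᴴ := by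
    have := congrArg conjTranspose (hB' U U.2)
    rw [conjTranspose_mul, conjTranspose_mul, conjTranspose_conjTranspose] at this
    exact this.symm
  simp only [Matrix.one_mul, Matrix.mul_assoc, h]

theorem mul_twirl_of_commute {A : Op (Pair d × Fin d)}
    (hA : ∀ U ∈ unitaryGroup (Fin d) ℂ, mixedTensor U * A = A * mixedTensor U)
    (Y : Op (Pair d × Fin d)) : twirl (A * Y) = A * twirl Y := by
  ext p q
  have := mul_twirl_mul_apply A Y 1 p q
  rw [Matrix.mul_one] at this
  rw [this]
  refine integral_congr_ae (.of_forall fun U => ?_)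
  simp only [Matrix.mul_one, ← Matrix.mul_assoc, hA U U.2]

theorem trace_twirl (Y : Op (Pair d × Fin d)) : (twirl Y).trace = Y.trace := by
  simp only [trace, diag_apply, twirl, of_apply]
  rw [← integral_finsetSum _ fun p _ => integrable_unitaryHaar (continuous_conj_apply Y p p)]
  have h : ∀ U : unitaryGroup (Fin d) ℂ,
      ∑ p, (mixedTensor (U : Op (Fin d)) * Y * (mixedTensor (U : Op (Fin d)))ᴴ) p p = Y.trace := by
    intro U
    change trace _ = _
    rw [trace_mul_comm, ← Matrix.mul_assoc, conjTranspose_mul_mixedTensor U.2, Matrix.one_mul]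
  simp only [h]
  simp [trace]

end Haar

/-! ### The moment estimate -/

section Moments

variable {d : ℕ}

variable (d) in
/-- The projector on the subrepresentation of `P± (H ⊗ H) ⊗ H*` equivalent to `H`. -/
noncomputable def vectorProj (i : Fin 2) : Op (Pair d × Fin d) :=
  (2 * (d + swapSign i) : ℂ)⁻¹ • (embed d i * (embed d i)ᴴ)

theorem vectorProj_conjTranspose (i : Fin 2) : (vectorProj d i)ᴴ = vectorProj d i := by
  simp [vectorProj, conjTranspose_smul, conjTranspose_mul]

theorem vectorProj_mul_self (hd : 2 ≤ d) (i : Fin 2) :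
    vectorProj d i * vectorProj d i = vectorProj d i := by
  have hk := embed_norm_ne_zero hd i
  rw [vectorProj, Matrix.smul_mul, Matrix.mul_smul, Matrix.mul_assoc,
    ← Matrix.mul_assoc _ (embed d i), embed_conjTranspose_mul_embed, Matrix.smul_mul,
    Matrix.mul_smul, Matrix.one_mul, smul_smul _ (2 * _ : ℂ), inv_mul_cancel₀ hk, one_smul]

theorem mixedProj_mul_vectorProj (i : Fin 2) :
    mixedProj d i * vectorProj d i = vectorProj d i := by
  rw [vectorProj, Matrix.mul_smul, ← Matrix.mul_assoc, mixedProj_mul_embed]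

theorem vectorProj_mul_mixedProj (i : Fin 2) :
    vectorProj d i * mixedProj d i = vectorProj d i := by
  have := congrArg conjTranspose (mixedProj_mul_vectorProj (d := d) i)
  rwa [conjTranspose_mul, vectorProj_conjTranspose, mixedProj_conjTranspose] at this

theorem mixedTensor_mul_vectorProj (i : Fin 2) (U : Op (Fin d))
    (hU : U ∈ unitaryGroup (Fin d) ℂ) :
    mixedTensor U * vectorProj d i = vectorProj d i * mixedTensor U := by
  rw [vectorProj, Matrix.mul_smul, Matrix.smul_mul, ← Matrix.mul_assoc, mixedTensor_mul_embed i hU,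
    Matrix.mul_assoc, Matrix.mul_assoc, embed_conjTranspose_mul_mixedTensor i hU]

theorem trace_vectorProj (hd : 2 ≤ d) (i : Fin 2) : (vectorProj d i).trace = d := by
  rw [vectorProj, trace_smul, trace_mul_comm, embed_conjTranspose_mul_embed, trace_smul, smul_smul,
    inv_mul_cancel₀ (embed_norm_ne_zero hd i), one_smul, trace_one, Fintype.card_fin]

/-- The squared Hilbert–Schmidt norm. -/
noncomputable def hsNormSq {n m : Type} [Fintype n] [Fintype m] (M : Matrix n m ℂ) : ℝ :=
  ∑ a, ∑ b, ‖M a b‖ ^ 2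

theorem hsNormSq_nonneg {n m : Type} [Fintype n] [Fintype m] (M : Matrix n m ℂ) :
    0 ≤ hsNormSq M :=
  Finset.sum_nonneg fun _ _ => Finset.sum_nonneg fun _ _ => sq_nonneg _

theorem trace_mul_conjTranspose_self {n m : Type} [Fintype n] [Fintype m] (M : Matrix n m ℂ) :
    (M * Mᴴ).trace = hsNormSq M := by
  simp only [trace, diag_apply, Matrix.mul_apply, conjTranspose_apply, hsNormSq]
  push_cast
  exact Finset.sum_congr rfl fun a _ => Finset.sum_congr rfl fun b _ => Complex.mul_conj' _

theorem trace_conjTranspose_mul_self_eq_hsNormSq {n m : Type} [Fintype n] [Fintype m]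
    (M : Matrix n m ℂ) :
    (Mᴴ * M).trace = hsNormSq M := by
  rw [trace_mul_comm, trace_mul_conjTranspose_self]

/-- The Pythagorean theorem for a pair of complementary projectors acting on the right. -/
theorem hsNormSq_mul_add {n m : Type} [Fintype n] [Fintype m] (M : Matrix n m ℂ) {Q Q' : Op m}
    (hQ : Qᴴ = Q) (hQ' : Q'ᴴ = Q') (h : Q * Q' = 0) :
    hsNormSq (M * (Q + Q')) = hsNormSq (M * Q) + hsNormSq (M * Q') := by
  have h' : Q' * Q = 0 := by
    have := congrArg conjTranspose h
    rwa [conjTranspose_mul, hQ, hQ', conjTranspose_zero] at this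
  have e : (Q + Q') * (Q + Q') = Q * Q + Q' * Q' := by
    rw [Matrix.add_mul, Matrix.mul_add, Matrix.mul_add, h, h', zero_add, add_zero]
  rw [← Complex.ofReal_inj]
  push_cast
  rw [← trace_mul_conjTranspose_self, ← trace_mul_conjTranspose_self,
    ← trace_mul_conjTranspose_self, conjTranspose_mul, conjTranspose_mul, conjTranspose_mul,
    conjTranspose_add, hQ, hQ', Matrix.mul_assoc, ← Matrix.mul_assoc (Q + Q'), e, Matrix.add_mul,
    Matrix.mul_add, trace_add]
  simp only [Matrix.mul_assoc]

theorem hsNormSq_mul_proj_le {n m : Type} [Fintype n] [Fintype m] [DecidableEq m] (M : Matrix n m ℂ)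
    {Q : Op m} (hQ : Qᴴ = Q) (hQQ : Q * Q = Q) : hsNormSq (M * Q) ≤ hsNormSq M := by
  have := hsNormSq_mul_add M (Q := Q) (Q' := 1 - Q) hQ (by simp [hQ])
    (by simp [Matrix.mul_sub, hQQ])
  rw [add_sub_cancel, Matrix.mul_one] at this
  linarith [hsNormSq_nonneg (M * (1 - Q))]

theorem hsNormSq_conjTranspose {n m : Type} [Fintype n] [Fintype m] (M : Matrix n m ℂ) :
    hsNormSq Mᴴ = hsNormSq M := by
  rw [← Complex.ofReal_inj, ← trace_mul_conjTranspose_self, conjTranspose_conjTranspose,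
    trace_conjTranspose_mul_self_eq_hsNormSq]

theorem hsNormSq_proj_mul_le {n m : Type} [Fintype n] [Fintype m] [DecidableEq m] (M : Matrix m n ℂ)
    {Q : Op m} (hQ : Qᴴ = Q) (hQQ : Q * Q = Q) : hsNormSq (Q * M) ≤ hsNormSq M := by
  rw [← hsNormSq_conjTranspose, conjTranspose_mul, hQ, ← hsNormSq_conjTranspose M]
  exact hsNormSq_mul_proj_le _ hQ hQQ

/-- The twirl of an operator supported on `P± (H ⊗ H) ⊗ H*`. When `d = 2` and the sign is `-`, the
complement of the vector subrepresentation is zero, and so is the corresponding denominator. -/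
theorem twirl_eq (hd : 2 ≤ d) (i : Fin 2) (Y : Op (Pair d × Fin d)) :
    twirl (mixedProj d i * Y * mixedProj d i)
      = (((mixedProj d i - vectorProj d i) * Y).trace / (projDim d i * d - d)) •
          (mixedProj d i - vectorProj d i)
        + ((vectorProj d i * Y).trace / d) • vectorProj d i := by
  set P := mixedProj d i with hP
  set Q := vectorProj d i with hQ
  have hd0 : (d : ℂ) ≠ 0 := by
    have : d ≠ 0 := by omega
    exact_mod_cast this
  have hPP : P * P = P := mixedProj_mul_self i
  have hPQ : P * Q = Q := mixedProj_mul_vectorProj i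
  have hQP : Q * P = Q := vectorProj_mul_mixedProj i
  have hQQ : Q * Q = Q := vectorProj_mul_self hd i
  have hPU : ∀ U ∈ unitaryGroup (Fin d) ℂ, mixedTensor U * P = P * mixedTensor U :=
    fun U _ => (mixedProj_mul_mixedTensor i U).symm
  have hQU : ∀ U ∈ unitaryGroup (Fin d) ℂ, mixedTensor U * Q = Q * mixedTensor U :=
    mixedTensor_mul_vectorProj i
  obtain ⟨l, m, h⟩ := exists_eq_of_commute_mixedTensor hd i
    (X := twirl (P * Y * P)) (mixedTensor_mul_twirl _)
    (by rw [← hP, ← twirl_mul_of_commute hPU, Matrix.mul_assoc, hPP])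
    (by rw [← hP, ← mul_twirl_of_commute hPU, ← Matrix.mul_assoc, ← Matrix.mul_assoc, hPP])
  have hk := embed_norm_ne_zero hd i
  have hE : embed d i * (embed d i)ᴴ = (2 * (d + swapSign i) : ℂ) • Q := by
    rw [hQ, vectorProj, smul_smul, mul_inv_cancel₀ hk, one_smul]
  obtain ⟨b, hb⟩ : ∃ b : ℂ, twirl (P * Y * P) = l • (P - Q) + b • Q := by
    refine ⟨l + m * (2 * (d + swapSign i)), ?_⟩
    rw [h, hE, ← hP, smul_smul]
    module
  have htP : P.trace = projDim d i * d := trace_mixedProj i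
  have htQ : Q.trace = d := trace_vectorProj hd i
  have htQ' : (P - Q).trace = projDim d i * d - d := by rw [trace_sub, htP, htQ]
  have htr : ∀ C : Op (Pair d × Fin d), C * P = C → P * C = C →
      (∀ U ∈ unitaryGroup (Fin d) ℂ, mixedTensor U * C = C * mixedTensor U) →
      (C * twirl (P * Y * P)).trace = (C * Y).trace := by
    intro C hCP hPC hC
    rw [← mul_twirl_of_commute hC, trace_twirl, ← Matrix.mul_assoc, ← Matrix.mul_assoc, hCP,
      trace_mul_comm, ← Matrix.mul_assoc, hPC]
  have h1 : b * d = (Q * Y).trace := by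
    rw [← htr Q hQP hPQ hQU, hb, Matrix.mul_add, Matrix.mul_smul, Matrix.mul_sub, hQP, hQQ,
      sub_self, smul_zero, zero_add, Matrix.mul_smul, hQQ, trace_smul, htQ, smul_eq_mul]
  have h2 : l * (projDim d i * d - d) = ((P - Q) * Y).trace := by
    rw [← htr (P - Q) (by rw [Matrix.sub_mul, hPP, hQP]) (by rw [Matrix.mul_sub, hPP, hPQ])
      (fun U hU => by rw [Matrix.mul_sub, Matrix.sub_mul, hPU U hU, hQU U hU]), hb, Matrix.mul_add,
      Matrix.mul_smul, Matrix.mul_smul, Matrix.sub_mul P Q Q, hPQ, hQQ, sub_self, smul_zero,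
      add_zero, Matrix.sub_mul, Matrix.mul_sub, Matrix.mul_sub, hPP, hPQ, hQP, hQQ, sub_self,
      sub_zero, trace_smul, htQ', smul_eq_mul]
  have hb' : b = (Q * Y).trace / d := by rw [← h1, mul_div_cancel_right₀ _ hd0]
  rw [hb, hb']
  congr 1
  by_cases h0 : (projDim d i * d - d : ℂ) = 0
  · have hz : P - Q = 0 := by
      rw [h0] at htQ'
      have hQ'Q' : (P - Q)ᴴ * (P - Q) = P - Q := by
        rw [conjTranspose_sub, hP, hQ, mixedProj_conjTranspose, vectorProj_conjTranspose, ← hP,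
          ← hQ, Matrix.sub_mul, Matrix.mul_sub, Matrix.mul_sub, hPP, hPQ, hQP, hQQ]
        simp
      rw [← trace_conjTranspose_mul_self_eq_zero_iff, hQ'Q', htQ']
    rw [hz, smul_zero, smul_zero]
  · rw [← h2, mul_div_cancel_right₀ _ h0]

/-- The average of `|∑ Mᵃᵇ* (U ⊗ U ⊗ U*)ᵃᵇ|²` in terms of twirls of rank-one operators. -/
theorem integral_norm_sq_eq_sum_twirl (i : Fin 2) (M : Op (Pair d × Fin d)) :
    ((∫ U : unitaryGroup (Fin d) ℂ,
      ‖∑ a, ∑ b, star (M a b) * (mixedTensor (U : Op (Fin d)) * mixedProj d i) a b‖ ^ 2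
        ∂(unitaryHaar (Fin d)) : ℝ) : ℂ)
      = ∑ b, ∑ e, ∑ a, ∑ c, star (M a b) * M c e *
          twirl (mixedProj d i * single b e (1 : ℂ) * mixedProj d i) a c := by
  have hpt : ∀ U : unitaryGroup (Fin d) ℂ,
      ((‖∑ a, ∑ b, star (M a b) * (mixedTensor (U : Op (Fin d)) * mixedProj d i) a b‖ ^ 2 : ℝ) : ℂ)
      = ∑ b, ∑ e, ∑ a, ∑ c, star (M a b) * M c e * (mixedTensor (U : Op (Fin d)) *
          (mixedProj d i * single b e (1 : ℂ) * mixedProj d i) *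
          (mixedTensor (U : Op (Fin d)))ᴴ) a c := by
    intro U
    have h : ∀ b e, mixedTensor (U : Op (Fin d)) *
          (mixedProj d i * single b e (1 : ℂ) * mixedProj d i) * (mixedTensor (U : Op (Fin d)))ᴴ
        = (mixedTensor (U : Op (Fin d)) * mixedProj d i) * single b e (1 : ℂ) *
          (mixedTensor (U : Op (Fin d)) * mixedProj d i)ᴴ := fun b e => by
      rw [conjTranspose_mul, mixedProj_conjTranspose]
      simp only [Matrix.mul_assoc]
    simp only [h, mul_single_mul_conjTranspose_apply]
    push_cast
    rw [← Complex.mul_conj']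
    simp only [map_sum, Finset.sum_mul, Finset.mul_sum]
    simp only [← Fintype.sum_prod_type']
    refine Fintype.sum_equiv
      { toFun := fun x : (Pair d × Fin d) × (Pair d × Fin d) × (Pair d × Fin d) ×
            (Pair d × Fin d) => (x.2.2.2, x.2.1, x.2.2.1, x.1)
        invFun := fun y => (y.2.2.2, y.2.1, y.2.2.1, y.1)
        left_inv := fun _ => rfl
        right_inv := fun _ => rfl } _ _ fun x => ?_
    simp
    ring
  have hi : ∀ b e a c, Integrable (fun U : unitaryGroup (Fin d) ℂ =>
      star (M a b) * M c e * (mixedTensor (U : Op (Fin d)) *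
        (mixedProj d i * single b e (1 : ℂ) * mixedProj d i) * (mixedTensor (U : Op (Fin d)))ᴴ) a c)
      (unitaryHaar (Fin d)) :=
    fun b e a c => (integrable_unitaryHaar (continuous_conj_apply _ a c)).const_mul _
  rw [← integral_complex_ofReal]
  simp only [hpt]
  rw [integral_finsetSum _ fun b _ => integrable_finsetSum _ fun e _ => integrable_finsetSum _
    fun a _ => integrable_finsetSum _ fun c _ => hi b e a c]
  refine Finset.sum_congr rfl fun b _ => ?_
  rw [integral_finsetSum _ fun e _ => integrable_finsetSum _
    fun a _ => integrable_finsetSum _ fun c _ => hi b e a c]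
  refine Finset.sum_congr rfl fun e _ => ?_
  rw [integral_finsetSum _ fun a _ => integrable_finsetSum _ fun c _ => hi b e a c]
  refine Finset.sum_congr rfl fun a _ => ?_
  rw [integral_finsetSum _ fun c _ => hi b e a c]
  refine Finset.sum_congr rfl fun c _ => ?_
  rw [integral_const_mul]
  rfl

/-- The contribution to the mean square of a coefficient of the isotypic projector `Q`, up to the
dimension factor. -/
theorem sum_mul_trace_mul_apply (M : Op (Pair d × Fin d)) {Q : Op (Pair d × Fin d)}
    (hQ : Qᴴ = Q) (hQQ : Q * Q = Q) :
    ∑ b, ∑ e, ∑ a, ∑ c, star (M a b) * M c e * ((Q * single b e (1 : ℂ)).trace * Q a c)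
      = hsNormSq (Q * M * Q) := by
  have h1 : ((hsNormSq (Q * M * Q) : ℝ) : ℂ) = (Mᴴ * (Q * M) * Q).trace := by
    have e : (Q * M * Q)ᴴ * (Q * M * Q) = Q * (Mᴴ * (Q * M) * Q) := by
      rw [conjTranspose_mul, conjTranspose_mul, hQ]
      simp only [Matrix.mul_assoc]
      rw [← Matrix.mul_assoc Q Q, hQQ]
    rw [← trace_conjTranspose_mul_self_eq_hsNormSq, e, trace_mul_comm, Matrix.mul_assoc, hQQ]
  rw [h1]
  have h2 : ∀ b e, (Q * single b e (1 : ℂ)).trace = Q e b := fun b e => by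
    simp [trace_mul_single]
  simp only [h2]
  simp only [trace, diag_apply, Matrix.mul_apply, conjTranspose_apply, Finset.sum_mul,
    Finset.mul_sum]
  refine Finset.sum_congr rfl fun b _ => Finset.sum_congr rfl fun e _ =>
    Finset.sum_congr rfl fun a _ => Finset.sum_congr rfl fun c _ => ?_
  ring

/-- The central moment estimate. On `P± (H ⊗ H) ⊗ H*` the representation `U ⊗ U ⊗ U*` is
multiplicity free, with all irreducible components of dimension at least `d`; by the orthogonality
relations, the mean square of a matrix coefficient is at most `1 / d` times its norm. -/
theorem integral_norm_sq_le (hd : 2 ≤ d) (i : Fin 2) (M : Op (Pair d × Fin d)) :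
    ∫ U : unitaryGroup (Fin d) ℂ,
      ‖∑ a, ∑ b, star (M a b) * (mixedTensor (U : Op (Fin d)) * mixedProj d i) a b‖ ^ 2
        ∂(unitaryHaar (Fin d)) ≤ 1 / d * hsNormSq (M * mixedProj d i) := by
  set P := mixedProj d i with hP
  set Q := vectorProj d i with hQ
  have hPP : P * P = P := mixedProj_mul_self i
  have hPQ : P * Q = Q := mixedProj_mul_vectorProj i
  have hQP : Q * P = Q := vectorProj_mul_mixedProj i
  have hQQ : Q * Q = Q := vectorProj_mul_self hd i
  have hQs : Qᴴ = Q := vectorProj_conjTranspose i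
  have hQs' : (P - Q)ᴴ = P - Q := by rw [conjTranspose_sub, hQs, hP, mixedProj_conjTranspose]
  have hQQ' : (P - Q) * (P - Q) = P - Q := by
    rw [Matrix.sub_mul, Matrix.mul_sub, Matrix.mul_sub, hPP, hPQ, hQP, hQQ, sub_self, sub_zero]
  have hort : Q * (P - Q) = 0 := by rw [Matrix.mul_sub, hQP, hQQ, sub_self]
  have hI : ∫ U : unitaryGroup (Fin d) ℂ,
      ‖∑ a, ∑ b, star (M a b) * (mixedTensor (U : Op (Fin d)) * P) a b‖ ^ 2
        ∂(unitaryHaar (Fin d))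
      = hsNormSq ((P - Q) * M * (P - Q)) / (projDim d i * d - d) + hsNormSq (Q * M * Q) / d := by
    rw [← Complex.ofReal_inj, integral_norm_sq_eq_sum_twirl]
    push_cast
    rw [← sum_mul_trace_mul_apply M hQs hQQ, ← sum_mul_trace_mul_apply M hQs' hQQ']
    have ht := twirl_eq hd i
    simp only [← hP, ← hQ] at ht
    simp only [← hP, ht, Matrix.add_apply, Matrix.smul_apply, smul_eq_mul,
      Finset.sum_div, ← Finset.sum_add_distrib]
    refine Finset.sum_congr rfl fun b _ => Finset.sum_congr rfl fun e _ =>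
      Finset.sum_congr rfl fun a _ => Finset.sum_congr rfl fun c _ => ?_
    ring
  have hpyth : hsNormSq (M * P) = hsNormSq (M * Q) + hsNormSq (M * (P - Q)) := by
    rw [← hsNormSq_mul_add M hQs hQs' hort, add_sub_cancel]
  have b1 : hsNormSq (Q * M * Q) ≤ hsNormSq (M * Q) := by
    rw [Matrix.mul_assoc]; exact hsNormSq_proj_mul_le _ hQs hQQ
  have b2 : hsNormSq ((P - Q) * M * (P - Q)) ≤ hsNormSq (M * (P - Q)) := by
    rw [Matrix.mul_assoc]; exact hsNormSq_proj_mul_le _ hQs' hQQ'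
  have hd2 : (2 : ℝ) ≤ d := by exact_mod_cast hd
  have hdpos : (0 : ℝ) < d := by linarith
  -- the complementary irreducible component has dimension zero or at least `d`
  have hdim : 0 ≤ 1 / (projDim d i * d - d) ∧ 1 / (projDim d i * d - d) ≤ 1 / (d : ℝ) := by
    have : projDim d i = 1 ∨ 2 ≤ projDim d i := by
      fin_cases i
      · right; simp [projDim]; nlinarith
      · rcases hd.eq_or_lt with rfl | h3
        · left; simp [projDim]; norm_num
        · right
          have h3' : (3 : ℝ) ≤ d := by exact_mod_cast h3
          simp [projDim]; nlinarith
    rcases this with h | h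
    · rw [h, one_mul, sub_self, div_zero]
      exact ⟨le_rfl, by positivity⟩
    · have h' : (d : ℝ) ≤ projDim d i * d - d := by nlinarith
      exact ⟨one_div_nonneg.mpr (hdpos.le.trans h'), one_div_le_one_div_of_le hdpos h'⟩
  rw [hI, hpyth, div_eq_mul_one_div, div_eq_mul_one_div _ (d : ℝ)]
  have := mul_le_mul b2 hdim.2 hdim.1 (hsNormSq_nonneg _)
  nlinarith [mul_le_mul_of_nonneg_right b1 (by positivity : 0 ≤ 1 / (d : ℝ))]

end Moments

/-! ### The upper bound on the average fidelity -/

section UpperBound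

variable {d : ℕ}

/-- A vector on `H₀ ⊗ H₁ ⊗ H₂ ⊗ H₃`, rearranged as an operator from `H₀ ⊗ H₁` to `H₃ ⊗ H₂`. -/
def regroup (v : NetIdx d → ℂ) : Op (Pair d × Fin d) :=
  of fun p q => v (q.1, q.2, p.2, p.1)

theorem regroup_apply (v : NetIdx d → ℂ) (p q : Pair d × Fin d) :
    regroup v p q = v (q.1, q.2, p.2, p.1) := rfl

/-- For `R = ∑ₙ |vₙ⟩⟨vₙ|`, the fidelity of the network with the gate `U` inserted is
`∑ₙ |⟨vₙ|ψ⟩|² / d⁴`, where `ψ` is the vector of `U ⊗ U ⊗ U*`. -/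
theorem channelFidelity_insertGate {ι : Type*} [Fintype ι] {R : Op (NetIdx d)}
    (v : ι → NetIdx d → ℂ) (hR : R = ∑ n, vecMulVec (v n) (star (v n))) (U : Op (Fin d)) :
    channelFidelity (insertGate R (choi (unitaryChannel U))) (U ⊗ₖ U)
      = (∑ n, ‖∑ p, ∑ q, star (regroup (v n) p q) * mixedTensor U p q‖ ^ 2) / (d : ℝ) ^ 4 := by
  have h : (insertGate R (choi (unitaryChannel U)) * choi (unitaryChannel (U ⊗ₖ U))).trace
      = ((∑ n, ‖∑ p, ∑ q, star (regroup (v n) p q) * mixedTensor U p q‖ ^ 2 : ℝ) : ℂ) := by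
    push_cast
    simp only [← Complex.conj_mul', map_sum, Finset.sum_mul, Finset.mul_sum]
    simp only [trace, diag_apply, Matrix.mul_apply, insertGate, of_apply,
      choi_unitaryChannel_apply, hR, Matrix.sum_apply, Finset.mul_sum, Finset.sum_mul]
    simp only [← Fintype.sum_prod_type']
    refine Fintype.sum_equiv
      { toFun := fun x : (Pair d × Pair d) × (Pair d × Pair d) ×
            Fin d × Fin d × Fin d × Fin d × ι =>
          (x.2.2.2.2.2.2, (x.2.1.1, x.2.2.2.1), (x.2.1.2, x.2.2.1),
            (x.1.1, x.2.2.2.2.2.1), (x.1.2, x.2.2.2.2.1))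
        invFun := fun y => ((y.2.2.2.1.1, y.2.2.2.2.1), (y.2.1.1, y.2.2.1.1), y.2.2.1.2, y.2.1.2,
          y.2.2.2.2.2, y.2.2.2.1.2, y.1)
        left_inv := fun _ => rfl
        right_inv := fun _ => rfl } _ _ fun x => ?_
    simp only [Equiv.coe_fn_mk, regroup_apply, mixedTensor_apply, vecMulVec_apply, Pi.star_apply,
      kroneckerMap_apply, starRingEnd_apply, star_mul', star_star]
    ring
  rw [channelFidelity, h, Complex.ofReal_re]
  congr 1
  simp
  ring

theorem hsNormSq_mul_mixedProj (i : Fin 2) (M : Op (Pair d × Fin d)) :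
    (hsNormSq (M * mixedProj d i) : ℂ)
      = ∑ p, ∑ q, ∑ r, star (M p q) * M p r * mixedProj d i r q := by
  have h : (M * mixedProj d i) * (M * mixedProj d i)ᴴ = M * (mixedProj d i * Mᴴ) := by
    rw [conjTranspose_mul, mixedProj_conjTranspose, Matrix.mul_assoc,
      ← Matrix.mul_assoc (mixedProj d i), mixedProj_mul_self]
  rw [← trace_mul_conjTranspose_self, h]
  simp only [trace, diag_apply, Matrix.mul_apply, conjTranspose_apply, Finset.mul_sum]
  refine Finset.sum_congr rfl fun p _ => ?_
  rw [Finset.sum_comm]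
  refine Finset.sum_congr rfl fun q _ => Finset.sum_congr rfl fun r _ => ?_
  ring

/-- The normalization of the network gives `Tr[R (P± ⊗ I)] = d d±`. -/
theorem sum_hsNormSq_regroup {ι : Type*} [Fintype ι] {R : Op (NetIdx d)} (hN : IsNetwork R)
    (v : ι → NetIdx d → ℂ) (hR : R = ∑ n, vecMulVec (v n) (star (v n))) (i : Fin 2) :
    ∑ n, hsNormSq (regroup (v n) * mixedProj d i) = d * projDim d i := by
  obtain ⟨-, R0, -, h3, h1⟩ := hN
  have hRa : ∀ x y, R x y = ∑ n, v n x * star (v n y) := fun x y => by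
    rw [hR, Matrix.sum_apply]
    rfl
  rw [← Complex.ofReal_inj]
  push_cast
  have e : ∑ n, (hsNormSq (regroup (v n) * mixedProj d i) : ℂ)
      = ∑ q, ∑ r, ∑ x2, (∑ x3, R (r.1, r.2, x2, x3) (q.1, q.2, x2, x3)) * mixedProj d i r q := by
    simp only [hsNormSq_mul_mixedProj, regroup_apply, hRa, Finset.sum_mul]
    simp only [Fintype.sum_prod_type (α₁ := Pair d) (α₂ := Fin d)]
    simp only [← Fintype.sum_prod_type']
    refine Fintype.sum_equiv
      { toFun := fun x : ι × Pair d × Fin d × Pair d × Fin d × Pair d × Fin d =>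
          (x.2.2.2.1, x.2.2.2.2.1, x.2.2.2.2.2.1, x.2.2.2.2.2.2, x.2.2.1, x.2.1, x.1)
        invFun := fun y =>
          (y.2.2.2.2.2.2, y.2.2.2.2.2.1, y.2.2.2.2.1, y.1, y.2.1, y.2.2.1, y.2.2.2.1)
        left_inv := fun _ => rfl
        right_inv := fun _ => rfl } _ _ fun x => ?_
    simp only [Equiv.coe_fn_mk]
    ring
  rw [e]
  simp only [h3, Matrix.one_apply_eq, one_mul, Finset.sum_const, Finset.card_univ, Fintype.card_fin,
    nsmul_eq_mul]
  have e2 : ∑ q : Pair d × Fin d, ∑ r : Pair d × Fin d,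
      (d : ℂ) * (R0 (r.1, r.2) (q.1, q.2) * mixedProj d i r q)
      = d * ∑ x0, ∑ y0, (∑ x1, R0 (y0, x1) (x0, x1)) * proj d i y0 x0 := by
    simp only [mixedProj_apply, Fintype.sum_prod_type (α₁ := Pair d) (α₂ := Fin d),
      Matrix.one_apply, mul_ite, mul_one, mul_zero, Finset.mul_sum, Finset.sum_mul]
    simp only [Finset.sum_ite_eq', Finset.mem_univ, if_true]
    exact Finset.sum_congr rfl fun x _ => Finset.sum_comm
  rw [e2]
  simp only [h1, Matrix.one_apply, ite_mul, one_mul, zero_mul, Finset.sum_ite_eq', Finset.mem_univ,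
    if_true]
  have := trace_proj (d := d) i
  simp only [trace, diag_apply] at this
  rw [this]

/-- Cauchy–Schwarz for two terms with weights `a / (a + b)` and `b / (a + b)`. -/
theorem norm_add_sq_le_weighted {a b : ℝ} (ha : 0 < a) (hb : 0 < b) (x y : ℂ) :
    ‖x + y‖ ^ 2 ≤ (a + b) / a * ‖x‖ ^ 2 + (a + b) / b * ‖y‖ ^ 2 := by
  have h1 : ‖x + y‖ ^ 2 ≤ (‖x‖ + ‖y‖) ^ 2 := by
    gcongr
    exact norm_add_le x y
  have h2 : (a + b) / a * ‖x‖ ^ 2 + (a + b) / b * ‖y‖ ^ 2 - (‖x‖ + ‖y‖) ^ 2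
      = (b * ‖x‖ - a * ‖y‖) ^ 2 / (a * b) := by
    field_simp
    ring
  have h3 : 0 ≤ (b * ‖x‖ - a * ‖y‖) ^ 2 / (a * b) := by positivity
  linarith

/-- The optimal fidelity bounds the average fidelity of every one-slot network. -/
theorem averageFidelity_le (hd : 2 ≤ d) {R : Op (NetIdx d)} (hN : IsNetwork R) :
    averageFidelity (fun U => insertGate R (choi (unitaryChannel U))) ≤ cloneFidelity d := by
  obtain ⟨m, v, hR⟩ := posSemidef_iff_eq_sum_vecMulVec.mp hN.1
  have ha : 0 < √(projDim d 0) := Real.sqrt_pos.mpr (projDim_pos hd 0)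
  have hb : 0 < √(projDim d 1) := Real.sqrt_pos.mpr (projDim_pos hd 1)
  set s := √(projDim d 0) + √(projDim d 1) with hs
  -- the amplitude of the component of `U ⊗ U ⊗ U*` in `P± (H ⊗ H) ⊗ H*`
  let g : Fin 2 → Fin m → unitaryGroup (Fin d) ℂ → ℂ := fun i n U =>
    ∑ p, ∑ q, star (regroup (v n) p q) * (mixedTensor (U : Op (Fin d)) * mixedProj d i) p q
  have hgc : ∀ i n, Continuous (g i n) := fun i n =>
    continuous_finsetSum _ fun p _ => continuous_finsetSum _ fun q _ => continuous_const.mul <| by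
      simp only [Matrix.mul_apply]
      exact continuous_finsetSum _ fun r _ =>
        (continuous_mixedTensor_apply p r).mul continuous_const
  have hgi : ∀ i n, Integrable (fun U => ‖g i n U‖ ^ 2) (unitaryHaar (Fin d)) := fun i n =>
    integrable_unitaryHaar ((hgc i n).norm.pow 2)
  have hsum : ∀ n (U : unitaryGroup (Fin d) ℂ),
      ∑ p, ∑ q, star (regroup (v n) p q) * mixedTensor (U : Op (Fin d)) p q
        = g 0 n U + g 1 n U := by
    intro n U
    have h : mixedTensor (U : Op (Fin d)) = mixedTensor (U : Op (Fin d)) * mixedProj d 0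
        + mixedTensor (U : Op (Fin d)) * mixedProj d 1 := by
      rw [← Matrix.mul_add, ← Fin.sum_univ_two (mixedProj d), sum_mixedProj, Matrix.mul_one]
    conv_lhs => rw [h]
    simp only [Matrix.add_apply, mul_add, Finset.sum_add_distrib, g]
  have hG : ∀ i, ∑ n, ∫ U, ‖g i n U‖ ^ 2 ∂(unitaryHaar (Fin d)) ≤ projDim d i := by
    intro i
    have hd0 : (d : ℝ) ≠ 0 := by positivity
    calc ∑ n, ∫ U, ‖g i n U‖ ^ 2 ∂(unitaryHaar (Fin d))
        ≤ ∑ n, 1 / d * hsNormSq (regroup (v n) * mixedProj d i) :=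
          Finset.sum_le_sum fun n _ => integral_norm_sq_le hd i (regroup (v n))
      _ = projDim d i := by
          rw [← Finset.mul_sum, sum_hsNormSq_regroup hN v hR, ← mul_assoc, one_div,
            inv_mul_cancel₀ hd0, one_mul]
  have hint : ∀ c : Fin 2 → ℝ, ∫ U, (∑ n, (c 0 * ‖g 0 n U‖ ^ 2 + c 1 * ‖g 1 n U‖ ^ 2))
        ∂(unitaryHaar (Fin d))
      = c 0 * (∑ n, ∫ U, ‖g 0 n U‖ ^ 2 ∂(unitaryHaar (Fin d)))
        + c 1 * ∑ n, ∫ U, ‖g 1 n U‖ ^ 2 ∂(unitaryHaar (Fin d)) := by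
    intro c
    have hi : ∀ n, Integrable (fun U => c 0 * ‖g 0 n U‖ ^ 2 + c 1 * ‖g 1 n U‖ ^ 2)
        (unitaryHaar (Fin d)) := fun n => ((hgi 0 n).const_mul _).add ((hgi 1 n).const_mul _)
    rw [integral_finsetSum _ fun n _ => hi n, Finset.mul_sum, Finset.mul_sum,
      ← Finset.sum_add_distrib]
    refine Finset.sum_congr rfl fun n _ => ?_
    rw [integral_add ((hgi 0 n).const_mul _) ((hgi 1 n).const_mul _), integral_const_mul,
      integral_const_mul]
  have hc : ∀ i, s / √(projDim d i) * projDim d i = s * √(projDim d i) := fun i => by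
    rw [div_mul_eq_mul_div, mul_div_assoc, Real.div_sqrt]
  unfold averageFidelity
  simp only [channelFidelity_insertGate v hR, hsum]
  rw [integral_div, cloneFidelity_eq hd, ← hs]
  gcongr
  calc ∫ U, ∑ n, ‖g 0 n U + g 1 n U‖ ^ 2 ∂(unitaryHaar (Fin d))
      ≤ ∫ U, ∑ n, (s / √(projDim d 0) * ‖g 0 n U‖ ^ 2 + s / √(projDim d 1) * ‖g 1 n U‖ ^ 2)
          ∂(unitaryHaar (Fin d)) := by
        refine integral_mono (integrable_finsetSum _ fun n _ => integrable_unitaryHaar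
          (((hgc 0 n).add (hgc 1 n)).norm.pow 2)) (integrable_finsetSum _ fun n _ =>
            ((hgi 0 n).const_mul _).add ((hgi 1 n).const_mul _)) fun U =>
              Finset.sum_le_sum fun n _ => norm_add_sq_le_weighted ha hb _ _
    _ = s / √(projDim d 0) * (∑ n, ∫ U, ‖g 0 n U‖ ^ 2 ∂(unitaryHaar (Fin d)))
        + s / √(projDim d 1) * ∑ n, ∫ U, ‖g 1 n U‖ ^ 2 ∂(unitaryHaar (Fin d)) :=
        hint fun i => s / √(projDim d i)
    _ ≤ s / √(projDim d 0) * projDim d 0 + s / √(projDim d 1) * projDim d 1 := by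
        gcongr
        · exact hG 0
        · exact hG 1
    _ = s ^ 2 := by rw [hc, hc, ← mul_add, ← hs, sq]

theorem averageFidelity_seqChannel (hd : 2 ≤ d) :
    averageFidelity (fun U => choi (seqChannel (preChannel d) (postChannel d) U))
      = cloneFidelity d := by
  unfold averageFidelity
  rw [integral_congr_ae (.of_forall fun U : unitaryGroup (Fin d) ℂ =>
    channelFidelity_seqChannel hd U.2)]
  simp

theorem abs_cloneFidelity_two_sub_lt : |cloneFidelity 2 - 0.4665| < 0.00005 := by
  have h : √(((2 : ℕ) : ℝ) ^ 2 - 1) = √3 := by norm_num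
  have h1 : (1.732 : ℝ) < √3 := Real.lt_sqrt_of_sq_lt (by norm_num)
  have h2 : √3 < (1.7321 : ℝ) := by
    rw [Real.sqrt_lt' (by norm_num)]
    norm_num
  rw [cloneFidelity, h, abs_lt]
  constructor <;> norm_num <;> linarith

end UpperBound

end UnitaryCloning

open UnitaryCloning in
theorem theorem1 (d : ℕ) (hd : 2 ≤ d) :
    -- the optimal average fidelity, over all networks and over all sequential networks
    IsGreatest (networkFidelities d) (cloneFidelity d) ∧
    IsGreatest (sequentialFidelities d) (cloneFidelity d) ∧
    -- its two expressions, and its value for qubits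
    cloneFidelity d = (√(projDim d 0) + √(projDim d 1)) ^ 2 / (d : ℝ) ^ 4 ∧
    |cloneFidelity 2 - 0.4665| < 0.00005 ∧
    -- the pre- and post-processing are channels, which define a network attaining the optimum
    IsChannel (preChannel d) ∧
    IsChannel (postChannel d) ∧
    averageFidelity (fun U => choi (seqChannel (preChannel d) (postChannel d) U))
      = cloneFidelity d ∧
    (∃ R : Op (NetIdx d), IsNetwork R ∧
      (∀ U ∈ Matrix.unitaryGroup (Fin d) ℂ, insertGate R (choi (unitaryChannel U))
        = choi (seqChannel (preChannel d) (postChannel d) U)) ∧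
      averageFidelity (fun U => insertGate R (choi (unitaryChannel U))) = cloneFidelity d) ∧
    -- the pre-processing is a controlled swap followed by discarding the second system
    controlledSwap d ∈ Matrix.unitaryGroup (Pair d × Fin 2) ℂ ∧
    (∀ ρ : Op (Pair d), preChannel d ρ
      = tensorId (Fin 2) partialTraceRight
          (controlledSwap d * (ρ ⊗ₖ Matrix.single 0 0 (1 : ℂ)) *
            (controlledSwap d).conjTranspose)) ∧
    -- the resulting clone of every `U`
    (∀ U ∈ Matrix.unitaryGroup (Fin d) ℂ,
      IsChannel (seqChannel (preChannel d) (postChannel d) U) ∧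
      (∀ ρ : Op (Pair d), seqChannel (preChannel d) (postChannel d) U ρ
        = ∑ i : Fin 2, ∑ j : Fin 2, (((d : ℝ) / √(projDim d i * projDim d j) : ℝ) : ℂ) •
            (proj d i * ((U * partialTraceRight (proj d i * ρ * proj d j) * U.conjTranspose)
              ⊗ₖ (1 : Op (Fin d))) * proj d j)) ∧
      channelFidelity (choi (seqChannel (preChannel d) (postChannel d) U)) (U ⊗ₖ U)
        = cloneFidelity d) := by
  have hpost := isChannel_postChannel hd
  have hseq := averageFidelity_seqChannel hd
  have hR := isNetwork_seqNetwork (isChannel_preChannel (d := d)) hpost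
  have hins := insertGate_seqNetwork (preChannel d) (postChannel d)
  have hRav : averageFidelity (fun U => insertGate (seqNetwork (preChannel d) (postChannel d))
      (choi (unitaryChannel U))) = cloneFidelity d := by simp only [hins, hseq]
  refine ⟨⟨⟨_, hR, hRav.symm⟩, ?_⟩, ⟨⟨2, _, _, isChannel_preChannel, hpost, hseq.symm⟩, ?_⟩,
    cloneFidelity_eq hd, abs_cloneFidelity_two_sub_lt, isChannel_preChannel, hpost, hseq,
    ⟨_, hR, fun U _ => hins U, hRav⟩, controlledSwap_mem_unitaryGroup, preChannel_eq_controlledSwap,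
    fun U hU => ⟨isChannel_seqChannel isChannel_preChannel hpost hU, seqChannel_apply U,
      channelFidelity_seqChannel hd hU⟩⟩
  · rintro F ⟨R, hN, rfl⟩
    exact averageFidelity_le hd hN
  · rintro F ⟨m, A, B, hA, hB, rfl⟩
    simp only [← insertGate_seqNetwork A B]
    exact averageFidelity_le hd (isNetwork_seqNetwork hA hB)
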